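/- **Setting.** A *topological graph* $E=(E^0,E^1,r,s)$ consists of second countable locally compact Hausdorff spaces $E^0,E^1$, a continuous map $r\colon E^1\to E^0$ and a local homeomorphism $s\colon E^1\to E^0$. It is *regular* if every $v\in E^0$ has a precompact open neighbourhood $U$ with $r^{-1}(\overline U)$ compact, and $v\notin\overline{E^0\setminus\overline{r(E^1)}}$. Its graph correspondence $X(E)$ is the $C_0(E^0)$–$C_0(E^0)$-correspondence obtained by completing $C_c(E^1)$ with the operations $(a\cdot x)(e)=a(r(e))x(e)$, $(x\cdot a)(e)=x(e)a(s(e))$, $(x\mid y)(v)=\sum_{s(e)=v}\overline{x(e)}y(e)$. An *out-split* of $E$ is a triple $\mathbb O=(\alpha,E^0_{\mathbb O},\psi)$ with $E^0_{\mathbb O}$ a locally compact Hausdorff space and $\alpha\colon E^0_{\mathbb O}\to E^0$, $\psi\colon E^1\to E^0_{\mathbb O}$ proper surjective local homeomorphisms such that $\alpha\circ\psi=s$. The out-split graph $E_{\mathbb O}$ has vertex space $E^0_{\mathbb O}$, edge space $\{(w,e)\in E^0_{\mathbb O}\times E^1:\alpha(w)=r(e)\}$, range $(w,e)\mapsto w$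 and source $(w,e)\mapsto\psi(e)$. **Proposition.** Let $\mathbb O=(\alpha,E^0_{\mathbb O},\psi)$ be an out-split of a regular topological graph $E$, and let $A=C_0(E^0)$, $B=C_0(E^0_{\mathbb O})$. 1. $\alpha^*(a)=a\circ\alpha$ defines an injective $*$-homomorphism $\alpha^*\colon A\to B$. 2. The formula $\Lambda(b)(v)=\sum_{u\in\alpha^{-1}(v)}b(u)$ defines a linear map $\Lambda\colon C_c(E^0_{\mathbb O})\to C_c(E^0)$ which is positive, faithful ($\Lambda(b^*b)=0$ implies $b=0$) and compatible with $\alpha^*$: $\Lambda(\alpha^*(a_1)\,b\,\alpha^*(a_2))=a_1\Lambda(b)a_2$ for $a_1,a_2\in A$. Let $B^\Lambda$ be the $B$–$A$-correspondence obtained by completing $C_c(E^0_{\mathbb O})$ in the inner product $(b\mid c)_A=\Lambda(b^*c)$, with right action $b\cdot a=b\,\alpha^*(a)$ and left multiplication by $B$. 3. $X(E)$ carries a right $B$-module structure with a definite $B$-valued inner product, given for $x,y\in C_c(E^1)$, $b\in B$ by $$(x\cdot b)(e)=x(e)b(\psi(e)),\qquad (x\mid y)_B(u)=\sum_{e\in\psi^{-1}(u)}\overline{x(e)}y(e).$$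 The left action of $A$ on $X(E)$ is also by adjointable operators for this structure. Moreover, for all $x,y\in X(E)$, $a\in A$, $v\in E^0$, one has $x\cdot\alpha^*(a)=x\cdot a$ and $\sum_{u\in\alpha^{-1}(v)}(x\mid y)_B(u)=(x\mid y)_A(v)$. 4. Let $B^\Lambda\otimes_A X(E)$ be the interior tensor product, that is, the completion of the algebraic tensor product in the inner product $(b_1\otimes x_1\mid b_2\otimes x_2)_B=(x_1\mid (b_1\mid b_2)_A\cdot x_2)_B$, with $B$ acting on the left on $B^\Lambda$ and on the right on $X(E)$. The correspondences $B^\Lambda\otimes_A X(E)$ and $X(E_{\mathbb O})$ over $B$ are isomorphic: there is a linear bijection between them that preserves the $B$-valued inner products and both actions of $B$. 5. Suppose that $\sup_{v}|\alpha^{-1}(v)|<\infty$ (for instance, $E^0$ compact). Then $\Lambda$ extends, by the same formula, to a bounded positive faithful linear map $\Lambda\colon B\to A$ with $\Lambda(\alpha^*(a_1)\,b\,\alpha^*(a_2))=a_1\Lambda(b)a_2$ and $\Lambda((x\mid y)_B)=(x\mid y)_A$ for all $x,y\in X(E)$; $X(E)$ is complete in the norm given by $(\cdot\mid\cdot)_B$,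 so it is an $A$–$B$-correspondence; and $B^\Lambda$ is the completion of all of $B$: the inclusion $C_c(E^0_{\mathbb O})\to B^\Lambda$ extends to a linear map $q\colon B\to B^\Lambda$ with dense range, $(q(b)\mid q(c))_A=\Lambda(b^*c)$, $b\cdot q(c)=q(bc)$ and $q(b)\cdot a=q(b\,\alpha^*(a))$. -/

import Mathlib

open scoped ZeroAtInfty ComplexOrder ComplexConjugate TensorProduct CompactlySupported
open UniformSpace

/-- A pre-`C₀(W)`-`C₀(Y)`-correspondence on a complex vector space `V`: a right `C₀(Y)`-module with
a positive semidefinite `C₀(Y)`-valued inner product (conjugate-linear in the first variable),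
together with a left action of `C₀(W)` by adjointable module operators. -/
structure PreCorrespondence (W Y V : Type*) [TopologicalSpace W] [TopologicalSpace Y]
    [AddCommGroup V] [Module ℂ V] where
  /-- the left action `a · x` -/
  left : C₀(W, ℂ) →ₗ[ℂ] V →ₗ[ℂ] V
  /-- the right action, `right b x = x · b` -/
  right : C₀(Y, ℂ) →ₗ[ℂ] V →ₗ[ℂ] V
  /-- the inner product `(x ∣ y)` -/
  ip : V →ₗ⋆[ℂ] V →ₗ[ℂ] C₀(Y, ℂ)
  ip_star : ∀ x y, star (ip x y) = ip y x
  ip_nonneg : ∀ x u, 0 ≤ ip x x u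
  ip_right : ∀ x y b, ip x (right b y) = ip x y * b
  right_mul : ∀ b c x, right (b * c) x = right c (right b x)
  left_mul : ∀ a c x, left (a * c) x = left a (left c x)
  ip_left : ∀ a x y, ip (left a x) y = ip x (left (star a) y)
  left_right : ∀ a b x, left a (right b x) = right b (left a x)

/-- A `C₀(W)`-`C₀(Y)`-correspondence: a pre-correspondence which is complete in the norm
`‖x‖ = ‖(x ∣ x)‖ ^ (1/2)` (a norm, so that the inner product is definite). -/
structure Correspondence (W Y X : Type*) [TopologicalSpace W] [TopologicalSpace Y]
    [NormedAddCommGroup X] [NormedSpace ℂ X] extends PreCorrespondence W Y X where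
  norm_sq : ∀ x, ‖x‖ ^ 2 = ‖ip x x‖
  complete : CompleteSpace X

/-- Two `C₀(W)`-`C₀(Y)`-correspondences are isomorphic if there is a linear bijection between them
that preserves the inner products and intertwines the left and the right actions. -/
def Correspondence.IsIsomorphic {W Y X X' : Type*} [TopologicalSpace W] [TopologicalSpace Y]
    [NormedAddCommGroup X] [NormedSpace ℂ X] [NormedAddCommGroup X'] [NormedSpace ℂ X']
    (P : Correspondence W Y X) (Q : Correspondence W Y X') : Prop :=
  ∃ β : X ≃ₗ[ℂ] X', (∀ x y, Q.ip (β x) (β y) = P.ip x y) ∧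
    (∀ x b, β (P.right b x) = Q.right b (β x)) ∧ (∀ a x, β (P.left a x) = Q.left a (β x))

namespace PreCorrespondence

variable {W Y V : Type*} [TopologicalSpace W] [TopologicalSpace Y] [AddCommGroup V] [Module ℂ V]

/-- The vector space `V`, to be equipped with the seminorm `‖x‖ = ‖(x ∣ x)‖ ^ (1/2)`. -/
def Carrier (_P : PreCorrespondence W Y V) : Type _ := V

variable (P : PreCorrespondence W Y V)

instance : AddCommGroup P.Carrier := inferInstanceAs (AddCommGroup V)

instance : Module ℂ P.Carrier := inferInstanceAs (Module ℂ V)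

/-- The identity map from `V` to the seminormed space `P.Carrier`. -/
def toCarrier : V ≃ₗ[ℂ] P.Carrier := LinearEquiv.refl ℂ V

theorem ip_star_apply (x y : V) (u : Y) : conj (P.ip x y u) = P.ip y x u := by
  rw [← P.ip_star x y]; rfl

theorem norm_ip_apply_sq_le (x y : V) (u : Y) :
    ‖P.ip x y u‖ * ‖P.ip x y u‖ ≤ ‖P.ip x x u‖ * ‖P.ip y y u‖ := by
  let core : PreInnerProductSpace.Core ℂ V :=
    { inner := fun x y => P.ip x y u
      conj_inner_symm := fun x y => P.ip_star_apply y x u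
      re_inner_nonneg := fun x => (Complex.nonneg_iff.1 (P.ip_nonneg x u)).1
      add_left := fun x y z => by simp
      smul_left := fun x y r => by simp }
  have h := @InnerProductSpace.Core.inner_mul_inner_self_le ℂ V _ _ _ core x y
  change ‖P.ip x y u‖ * ‖P.ip y x u‖ ≤ (P.ip x x u).re * (P.ip y y u).re at h
  rw [← P.ip_star_apply x y u, RCLike.norm_conj] at h
  exact h.trans (mul_le_mul (Complex.re_le_norm _) (Complex.re_le_norm _)
    (Complex.nonneg_iff.1 (P.ip_nonneg y u)).1 (norm_nonneg _))

theorem norm_apply_le (f : C₀(Y, ℂ)) (u : Y) : ‖f u‖ ≤ ‖f‖ :=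
  f.toBCF.norm_coe_le_norm u

theorem norm_le_of_forall (f : C₀(Y, ℂ)) {C : ℝ} (hC : 0 ≤ C) (h : ∀ u, ‖f u‖ ≤ C) : ‖f‖ ≤ C :=
  (BoundedContinuousFunction.norm_le (f := f.toBCF) hC).2 h

theorem norm_ip_le (x y : V) : ‖P.ip x y‖ ≤ √‖P.ip x x‖ * √‖P.ip y y‖ := by
  refine norm_le_of_forall _ (by positivity) fun u => ?_
  rw [← Real.sqrt_mul (norm_nonneg _)]
  refine Real.le_sqrt_of_sq_le ?_
  rw [sq]
  exact (P.norm_ip_apply_sq_le x y u).trans (mul_le_mul (norm_apply_le _ u) (norm_apply_le _ u)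
    (norm_nonneg _) (norm_nonneg _))

noncomputable instance : Norm P.Carrier :=
  ⟨fun x => √‖P.ip (P.toCarrier.symm x) (P.toCarrier.symm x)‖⟩

theorem norm_def (x : P.Carrier) : ‖x‖ = √‖P.ip (P.toCarrier.symm x) (P.toCarrier.symm x)‖ := rfl

theorem core : SeminormedSpace.Core ℂ P.Carrier where
  norm_nonneg x := Real.sqrt_nonneg _
  norm_smul c x := by
    rw [norm_def, norm_def, map_smul]
    set v := P.toCarrier.symm x
    have : P.ip (c • v) (c • v) = (conj c * c) • P.ip v v := by
      simp [smul_smul, mul_comm]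
    rw [this, norm_smul, norm_mul, RCLike.norm_conj, Real.sqrt_mul (by positivity),
      Real.sqrt_mul_self (norm_nonneg _)]
  norm_triangle x y := by
    refine Real.sqrt_le_iff.2 ⟨by rw [norm_def, norm_def]; positivity, ?_⟩
    rw [norm_def, norm_def, map_add]
    set v := P.toCarrier.symm x
    set w := P.toCarrier.symm y
    have h : P.ip (v + w) (v + w) = P.ip v v + P.ip v w + (P.ip w v + P.ip w w) := by
      simp only [map_add, LinearMap.add_apply]; abel
    have h1 := P.norm_ip_le v w
    have h2 := P.norm_ip_le w v
    have h3 := norm_add₃_le (a := P.ip v v) (b := P.ip v w) (c := P.ip w v + P.ip w w)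
    have h4 := norm_add_le (P.ip w v) (P.ip w w)
    have h5 := Real.mul_self_sqrt (norm_nonneg (P.ip v v))
    have h6 := Real.mul_self_sqrt (norm_nonneg (P.ip w w))
    rw [h]
    nlinarith

noncomputable instance : SeminormedAddCommGroup P.Carrier := SeminormedAddCommGroup.ofCore P.core

noncomputable instance : NormedSpace ℂ P.Carrier where
  norm_smul_le c x := (P.core.norm_smul c x).le

theorem norm_toCarrier (v : V) : ‖P.toCarrier v‖ = √‖P.ip v v‖ := by
  rw [norm_def, LinearEquiv.symm_apply_apply]

theorem norm_sq_toCarrier (v : V) : ‖P.toCarrier v‖ ^ 2 = ‖P.ip v v‖ := by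
  rw [norm_toCarrier, Real.sq_sqrt (norm_nonneg _)]

theorem right_left (b : C₀(Y, ℂ)) (x y : V) : P.ip (P.right b x) y = star b * P.ip x y := by
  rw [← P.ip_star, P.ip_right, ← P.ip_star x y]
  ext u
  simp [mul_comm]

theorem norm_right_le (b : C₀(Y, ℂ)) (v : V) :
    ‖P.toCarrier (P.right b v)‖ ≤ ‖b‖ * ‖P.toCarrier v‖ := by
  rw [norm_toCarrier]
  refine Real.sqrt_le_iff.2 ⟨by positivity, ?_⟩
  rw [mul_pow, norm_sq_toCarrier, P.ip_right, P.right_left]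
  refine (norm_mul_le _ _).trans ?_
  have := norm_mul_le (star b) (P.ip v v)
  have hs : ‖star b‖ = ‖b‖ := norm_star b
  rw [hs] at this
  nlinarith [norm_nonneg b]

/-- The function `(‖a‖ ^ 2 - |a| ^ 2) ^ (1/2) - ‖a‖`. -/
noncomputable def defect (a : C₀(W, ℂ)) : C₀(W, ℂ) where
  toFun w := ((√(‖a‖ ^ 2 - ‖a w‖ ^ 2) - ‖a‖ : ℝ) : ℂ)
  continuous_toFun := by fun_prop
  zero_at_infty' := by
    have h : Filter.Tendsto (fun w => ‖a w‖) (Filter.cocompact W) (nhds 0) := by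
      simpa using a.zero_at_infty'.norm
    have h2 : Filter.Tendsto (fun t : ℝ => ((√(‖a‖ ^ 2 - t ^ 2) - ‖a‖ : ℝ) : ℂ)) (nhds 0)
        (nhds 0) := by
      have : Continuous (fun t : ℝ => ((√(‖a‖ ^ 2 - t ^ 2) - ‖a‖ : ℝ) : ℂ)) := by fun_prop
      simpa [Real.sqrt_sq (norm_nonneg a)] using this.tendsto 0
    exact h2.comp h

theorem defect_spec (a : C₀(W, ℂ)) :
    star (defect a) * defect a + (2 * ‖a‖ : ℂ) • defect a = - (star a * a) := by
  ext w
  have h : 0 ≤ ‖a‖ ^ 2 - ‖a w‖ ^ 2 := by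
    have := norm_apply_le a w
    nlinarith [norm_nonneg (a w)]
  have h1 : conj (a w) * a w = ((‖a w‖ ^ 2 : ℝ) : ℂ) := by
    rw [Complex.conj_mul']; norm_cast
  change conj (((√(‖a‖ ^ 2 - ‖a w‖ ^ 2) - ‖a‖ : ℝ) : ℂ))
    * ((√(‖a‖ ^ 2 - ‖a w‖ ^ 2) - ‖a‖ : ℝ) : ℂ)
    + (2 * ‖a‖ : ℂ) * ((√(‖a‖ ^ 2 - ‖a w‖ ^ 2) - ‖a‖ : ℝ) : ℂ) = - (conj (a w) * a w)
  rw [h1, Complex.conj_ofReal]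
  norm_cast
  nlinarith [Real.sq_sqrt h]

theorem star_defect (a : C₀(W, ℂ)) : star (defect a) = defect a := by
  ext w
  exact Complex.conj_ofReal _

theorem norm_left_le (a : C₀(W, ℂ)) (v : V) :
    ‖P.toCarrier (P.left a v)‖ ≤ ‖a‖ * ‖P.toCarrier v‖ := by
  rw [norm_toCarrier]
  refine Real.sqrt_le_iff.2 ⟨by positivity, ?_⟩
  rw [mul_pow, norm_sq_toCarrier]
  refine norm_le_of_forall _ (by positivity) fun u => ?_
  set d := defect a
  have key : P.ip ((‖a‖ : ℂ) • v + P.left d v) ((‖a‖ : ℂ) • v + P.left d v)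
      = ((‖a‖ ^ 2 : ℝ) : ℂ) • P.ip v v - P.ip (P.left a v) (P.left a v) := by
    have e1 : P.ip (P.left d v) (P.left d v) = P.ip v (P.left (star d * d) v) := by
      rw [P.ip_left, P.left_mul]
    have e2 : P.ip (P.left a v) (P.left a v) = P.ip v (P.left (star a * a) v) := by
      rw [P.ip_left, P.left_mul]
    have e3 : P.ip (P.left d v) v = P.ip v (P.left d v) := by
      rw [P.ip_left, star_defect]
    have e4 : P.ip v (P.left (star d * d) v) + (2 * ‖a‖ : ℂ) • P.ip v (P.left d v)
        = - P.ip v (P.left (star a * a) v) := by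
      have := congrArg (fun f => P.ip v (P.left f v)) (defect_spec a)
      simpa using this
    simp only [map_add, LinearMap.add_apply, map_smulₛₗ, LinearMap.smul_apply, e1, e2, e3,
      Complex.conj_ofReal, RingHom.id_apply]
    rw [sub_eq_add_neg, ← e4]
    push_cast
    module
  have h1 := P.ip_nonneg ((‖a‖ : ℂ) • v + P.left d v) u
  rw [key] at h1
  have h2 : P.ip (P.left a v) (P.left a v) u ≤ ((‖a‖ ^ 2 : ℝ) : ℂ) * P.ip v v u := by
    simpa using h1
  have h3 := CStarAlgebra.norm_le_norm_of_nonneg_of_le (P.ip_nonneg (P.left a v) u) h2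
  refine h3.trans ?_
  rw [norm_mul, Complex.norm_real, norm_pow, norm_norm]
  gcongr
  exact norm_apply_le _ u

/-- The left action as bounded operators. -/
noncomputable def leftL (a : C₀(W, ℂ)) : P.Carrier →L[ℂ] P.Carrier :=
  ((P.toCarrier : V →ₗ[ℂ] P.Carrier) ∘ₗ P.left a ∘ₗ (P.toCarrier.symm : P.Carrier →ₗ[ℂ] V)).mkContinuous
    ‖a‖ fun x => P.norm_left_le a (P.toCarrier.symm x)

/-- The right action as bounded operators. -/
noncomputable def rightL (b : C₀(Y, ℂ)) : P.Carrier →L[ℂ] P.Carrier :=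
  ((P.toCarrier : V →ₗ[ℂ] P.Carrier) ∘ₗ P.right b ∘ₗ (P.toCarrier.symm : P.Carrier →ₗ[ℂ] V)).mkContinuous
    ‖b‖ fun x => P.norm_right_le b (P.toCarrier.symm x)

/-- The inner product with a fixed vector as a bounded map. -/
noncomputable def ipL (v : V) : P.Carrier →L[ℂ] C₀(Y, ℂ) :=
  ((P.ip v) ∘ₗ (P.toCarrier.symm : P.Carrier →ₗ[ℂ] V)).mkContinuous
    ‖P.toCarrier v‖ fun x => P.norm_ip_le v (P.toCarrier.symm x)

theorem ipL_apply (v w : V) : P.ipL v (P.toCarrier w) = P.ip v w := rfl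

/-- The inner product, extended to the completion in the second variable. -/
noncomputable def ipR : P.Carrier →ₗ⋆[ℂ] Completion P.Carrier →L[ℂ] C₀(Y, ℂ) where
  toFun x := (P.ipL (P.toCarrier.symm x)).fromCompletion
  map_add' x y := ContinuousLinearMap.fromCompletion_unique _ _ fun e => by
    obtain ⟨w, rfl⟩ := P.toCarrier.surjective e
    rw [_root_.add_apply, ContinuousLinearMap.fromCompletion_apply_coe,
      ContinuousLinearMap.fromCompletion_apply_coe, ipL_apply, ipL_apply, ipL_apply, map_add,
      map_add, LinearMap.add_apply]
  map_smul' c x := ContinuousLinearMap.fromCompletion_unique _ _ fun e => by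
    obtain ⟨w, rfl⟩ := P.toCarrier.surjective e
    rw [_root_.smul_apply, ContinuousLinearMap.fromCompletion_apply_coe,
      ipL_apply, ipL_apply, map_smul, map_smulₛₗ, LinearMap.smul_apply]

theorem norm_ipR_le (x : P.Carrier) : ‖P.ipR x‖ ≤ 1 * ‖x‖ := by
  refine ContinuousLinearMap.opNorm_le_bound _ (by positivity) fun y => ?_
  induction y using Completion.induction_on with
  | hp => exact isClosed_le (by fun_prop) (by fun_prop)
  | ih y =>
    change ‖(P.ipL (P.toCarrier.symm x)).fromCompletion (y : Completion P.Carrier)‖ ≤ _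
    rw [ContinuousLinearMap.fromCompletion_apply_coe, one_mul, Completion.norm_coe]
    exact P.norm_ip_le (P.toCarrier.symm x) (P.toCarrier.symm y)

/-- The map `ipR` as a bounded map. -/
noncomputable def ipM : P.Carrier →L⋆[ℂ] Completion P.Carrier →L[ℂ] C₀(Y, ℂ) :=
  LinearMap.mkContinuous (𝕜 := ℂ) (𝕜₂ := ℂ) (σ := starRingEnd ℂ) (E := P.Carrier)
    (F := Completion P.Carrier →L[ℂ] C₀(Y, ℂ)) P.ipR 1 P.norm_ipR_le

/-- The inner product, extended to the completion in both variables. -/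
noncomputable def ipC : Completion P.Carrier →L⋆[ℂ] Completion P.Carrier →L[ℂ] C₀(Y, ℂ) :=
  ContinuousLinearMap.fromCompletion (R₁ := ℂ) (R₂ := ℂ) (σ := starRingEnd ℂ) (α := P.Carrier)
    (β := Completion P.Carrier →L[ℂ] C₀(Y, ℂ)) P.ipM

/-- The canonical linear map from `V` to its completion. -/
noncomputable def ι : V →ₗ[ℂ] Completion P.Carrier where
  toFun v := (P.toCarrier v : Completion P.Carrier)
  map_add' v w := by rw [map_add, Completion.coe_add]
  map_smul' c v := by rw [map_smul, Completion.coe_smul]; rfl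

theorem norm_sq_ι (v : V) : ‖P.ι v‖ ^ 2 = ‖P.ip v v‖ := by
  rw [← norm_sq_toCarrier]
  exact congrArg (· ^ 2) (Completion.norm_coe (P.toCarrier v))

theorem denseRange_ι : DenseRange P.ι :=
  Completion.denseRange_coe.comp P.toCarrier.surjective.denseRange (Completion.continuous_coe _)

theorem induction_ι {p : Completion P.Carrier → Prop} (x : Completion P.Carrier)
    (hp : IsClosed {x | p x}) (h : ∀ v, p (P.ι v)) : p x :=
  P.denseRange_ι.induction_on x hp h

theorem induction_ι₂ {p : Completion P.Carrier → Completion P.Carrier → Prop}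
    (x y : Completion P.Carrier)
    (hp : IsClosed {z : Completion P.Carrier × Completion P.Carrier | p z.1 z.2})
    (h : ∀ v w, p (P.ι v) (P.ι w)) : p x y :=
  P.denseRange_ι.induction_on₂ hp h x y

theorem ipC_ι (v w : V) : P.ipC (P.ι v) (P.ι w) = P.ip v w := by
  change P.ipC ((P.toCarrier v : P.Carrier) : Completion P.Carrier) _ = _
  rw [ipC, ContinuousLinearMap.fromCompletion_apply_coe]
  exact ContinuousLinearMap.fromCompletion_apply_coe _ _

theorem continuous_ipC {T : Type*} [TopologicalSpace T] {f g : T → Completion P.Carrier}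
    (hf : Continuous f) (hg : Continuous g) : Continuous fun t => P.ipC (f t) (g t) :=
  (P.ipC.continuous.comp hf).clm_apply hg

theorem leftL_ι (a : C₀(W, ℂ)) (v : V) : (P.leftL a).completion (P.ι v) = P.ι (P.left a v) :=
  ContinuousLinearMap.completion_apply_coe _ _

theorem rightL_ι (b : C₀(Y, ℂ)) (v : V) : (P.rightL b).completion (P.ι v) = P.ι (P.right b v) :=
  ContinuousLinearMap.completion_apply_coe _ _

theorem continuous_eval (u : Y) : Continuous fun f : C₀(Y, ℂ) => f u := by
  have : LipschitzWith 1 fun f : C₀(Y, ℂ) => f u := LipschitzWith.of_dist_le_mul fun f g => by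
    rw [NNReal.coe_one, one_mul, dist_eq_norm, dist_eq_norm]
    exact norm_apply_le (f - g) u
  exact this.continuous

/-- The left action, extended to the completion. -/
noncomputable def leftC : C₀(W, ℂ) →ₗ[ℂ] Completion P.Carrier →ₗ[ℂ] Completion P.Carrier where
  toFun a := ((P.leftL a).completion : Completion P.Carrier →ₗ[ℂ] Completion P.Carrier)
  map_add' a c := LinearMap.ext fun x => by
    change (P.leftL (a + c)).completion x = (P.leftL a).completion x + (P.leftL c).completion x
    induction x using P.induction_ι with
    | hp =>
      exact isClosed_eq (ContinuousLinearMap.continuous _)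
        ((ContinuousLinearMap.continuous _).add (ContinuousLinearMap.continuous _))
    | h v =>
      rw [leftL_ι, leftL_ι, leftL_ι, map_add, LinearMap.add_apply, map_add]
  map_smul' k a := LinearMap.ext fun x => by
    change (P.leftL (k • a)).completion x = k • (P.leftL a).completion x
    induction x using P.induction_ι with
    | hp =>
      exact isClosed_eq (ContinuousLinearMap.continuous _)
        ((ContinuousLinearMap.continuous _).const_smul k)
    | h v =>
      rw [leftL_ι, leftL_ι, map_smul, LinearMap.smul_apply, map_smul]

/-- The right action, extended to the completion. -/
noncomputable def rightC : C₀(Y, ℂ) →ₗ[ℂ] Completion P.Carrier →ₗ[ℂ] Completion P.Carrier where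
  toFun b := ((P.rightL b).completion : Completion P.Carrier →ₗ[ℂ] Completion P.Carrier)
  map_add' b c := LinearMap.ext fun x => by
    change (P.rightL (b + c)).completion x = (P.rightL b).completion x + (P.rightL c).completion x
    induction x using P.induction_ι with
    | hp =>
      exact isClosed_eq (ContinuousLinearMap.continuous _)
        ((ContinuousLinearMap.continuous _).add (ContinuousLinearMap.continuous _))
    | h v =>
      rw [rightL_ι, rightL_ι, rightL_ι, map_add, LinearMap.add_apply, map_add]
  map_smul' k b := LinearMap.ext fun x => by
    change (P.rightL (k • b)).completion x = k • (P.rightL b).completion x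
    induction x using P.induction_ι with
    | hp =>
      exact isClosed_eq (ContinuousLinearMap.continuous _)
        ((ContinuousLinearMap.continuous _).const_smul k)
    | h v =>
      rw [rightL_ι, rightL_ι, map_smul, LinearMap.smul_apply, map_smul]

theorem continuous_leftC (a : C₀(W, ℂ)) : Continuous (P.leftC a) :=
  (P.leftL a).completion.continuous

theorem continuous_rightC (b : C₀(Y, ℂ)) : Continuous (P.rightC b) :=
  (P.rightL b).completion.continuous

theorem leftC_ι (a : C₀(W, ℂ)) (v : V) : P.leftC a (P.ι v) = P.ι (P.left a v) := P.leftL_ι a v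

theorem rightC_ι (b : C₀(Y, ℂ)) (v : V) : P.rightC b (P.ι v) = P.ι (P.right b v) := P.rightL_ι b v

/-- The completion of a pre-correspondence (after the vectors of length zero are divided out): all
operations are the continuous extensions of those on `V`. -/
noncomputable def completion : Correspondence W Y (Completion P.Carrier) where
  left := P.leftC
  right := P.rightC
  ip :=
    { toFun := fun x => (P.ipC x : Completion P.Carrier →ₗ[ℂ] C₀(Y, ℂ))
      map_add' := fun x y => by rw [map_add]; rfl
      map_smul' := fun k x => by rw [map_smulₛₗ]; rfl }
  ip_star x y := by
    change star (P.ipC x y) = P.ipC y x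
    induction x, y using P.induction_ι₂ with
    | hp =>
      exact isClosed_eq
          (continuous_star.comp (P.continuous_ipC continuous_fst continuous_snd))
          (P.continuous_ipC continuous_snd continuous_fst)
    | h v w =>
      rw [ipC_ι, ipC_ι, P.ip_star]
  ip_nonneg x u := by
    change 0 ≤ P.ipC x x u
    induction x using P.induction_ι with
    | hp =>
      exact isClosed_le continuous_const
          ((continuous_eval u).comp (P.continuous_ipC continuous_id continuous_id))
    | h v =>
      rw [ipC_ι]
      exact P.ip_nonneg v u
  ip_right x y b := by
    change P.ipC x (P.rightC b y) = P.ipC x y * b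
    induction x, y using P.induction_ι₂ with
    | hp =>
      exact isClosed_eq
          (P.continuous_ipC continuous_fst ((P.continuous_rightC b).comp continuous_snd))
          ((P.continuous_ipC continuous_fst continuous_snd).mul continuous_const)
    | h v w =>
      rw [rightC_ι, ipC_ι, ipC_ι, P.ip_right]
  right_mul b c x := by
    induction x using P.induction_ι with
    | hp =>
      exact isClosed_eq (P.continuous_rightC _)
          ((P.continuous_rightC c).comp (P.continuous_rightC b))
    | h v =>
      rw [rightC_ι, rightC_ι, rightC_ι, P.right_mul]
  left_mul a c x := by
    induction x using P.induction_ι with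
    | hp =>
      exact isClosed_eq (P.continuous_leftC _)
          ((P.continuous_leftC a).comp (P.continuous_leftC c))
    | h v =>
      rw [leftC_ι, leftC_ι, leftC_ι, P.left_mul]
  ip_left a x y := by
    change P.ipC (P.leftC a x) y = P.ipC x (P.leftC (star a) y)
    induction x, y using P.induction_ι₂ with
    | hp =>
      exact isClosed_eq
          (P.continuous_ipC ((P.continuous_leftC a).comp continuous_fst) continuous_snd)
          (P.continuous_ipC continuous_fst ((P.continuous_leftC _).comp continuous_snd))
    | h v w =>
      rw [leftC_ι, leftC_ι, ipC_ι, ipC_ι, P.ip_left]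
  left_right a b x := by
    induction x using P.induction_ι with
    | hp =>
      exact isClosed_eq ((P.continuous_leftC a).comp (P.continuous_rightC b))
          ((P.continuous_rightC b).comp (P.continuous_leftC a))
    | h v =>
      rw [leftC_ι, rightC_ι, rightC_ι, leftC_ι, P.left_right]
  norm_sq x := by
    change ‖x‖ ^ 2 = ‖P.ipC x x‖
    induction x using P.induction_ι with
    | hp =>
      exact isClosed_eq (by fun_prop)
          (P.continuous_ipC continuous_id continuous_id).norm
    | h v =>
      rw [ipC_ι, norm_sq_ι]
  complete := inferInstance

theorem completion_left_ι (a : C₀(W, ℂ)) (v : V) :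
    P.completion.left a (P.ι v) = P.ι (P.left a v) := P.leftC_ι a v

theorem completion_right_ι (b : C₀(Y, ℂ)) (v : V) :
    P.completion.right b (P.ι v) = P.ι (P.right b v) := P.rightC_ι b v

theorem completion_ip_ι (v w : V) : P.completion.ip (P.ι v) (P.ι w) = P.ip v w := P.ipC_ι v w

end PreCorrespondence

section GramRoot

open scoped Matrix.Norms.L2Operator MatrixOrder

/-- A continuous family of positive matrices, vanishing at infinity, has a continuous square root
that vanishes at infinity. -/
theorem exists_sqrt_of_posSemidef {Z ι : Type*} [TopologicalSpace Z] [Fintype ι] [DecidableEq ι]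
    (g : ι → ι → C₀(Z, ℂ)) (hg : ∀ z, (Matrix.of fun i j => g i j z).PosSemidef) :
    ∃ s : ι → ι → C₀(Z, ℂ), ∀ i j, g i j = ∑ k, star (s k i) * s k j := by
  let G : Z → Matrix ι ι ℂ := fun z => Matrix.of fun i j => g i j z
  have hG0 : ∀ z, 0 ≤ G z := fun z => (hg z).nonneg
  have hGc : Continuous G := continuous_matrix fun i j => (g i j).continuous
  have hGt : Filter.Tendsto G (Filter.cocompact Z) (nhds 0) := by
    refine tendsto_pi_nhds.2 fun i => tendsto_pi_nhds.2 fun j => ?_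
    exact (g i j).zero_at_infty'
  have hsc : Continuous fun z => CFC.sqrt (G z) :=
    CFC.continuousOn_sqrt.comp_continuous hGc hG0
  have hst : Filter.Tendsto (fun z => CFC.sqrt (G z)) (Filter.cocompact Z) (nhds 0) := by
    have h := (CFC.continuousOn_sqrt (A := Matrix ι ι ℂ)).continuousWithinAt (x := 0) (le_refl (0 : Matrix ι ι ℂ))
    have h' := h.tendsto.comp (tendsto_nhdsWithin_iff.2 ⟨hGt, Filter.Eventually.of_forall hG0⟩)
    have h0 : CFC.sqrt (0 : Matrix ι ι ℂ) = 0 := CFC.sqrt_zero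
    rw [h0] at h'
    exact h'
  refine ⟨fun i j => ⟨⟨fun z => CFC.sqrt (G z) i j, hsc.matrix_elem i j⟩, ?_⟩, fun i j => ?_⟩
  · exact (((continuous_id.matrix_elem i j).tendsto (0 : Matrix ι ι ℂ)).comp hst)
  · ext z
    have h1 : CFC.sqrt (G z) * CFC.sqrt (G z) = G z := CFC.sqrt_mul_sqrt_self (G z) (hG0 z)
    have h2 : (CFC.sqrt (G z)).conjTranspose = CFC.sqrt (G z) :=
      (CFC.sqrt_nonneg (G z)).isSelfAdjoint
    have h3 : g i j z = ((CFC.sqrt (G z)).conjTranspose * CFC.sqrt (G z)) i j := by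
      rw [h2, h1]; rfl
    rw [h3, Matrix.mul_apply]
    have h4 : ∀ F : ι → C₀(Z, ℂ), (∑ k, F k) z = ∑ k, F k z := fun F =>
      map_sum (AddMonoidHom.mk' (fun f : C₀(Z, ℂ) => f z) fun _ _ => rfl) F Finset.univ
    rw [h4]
    rfl

end GramRoot

namespace PreCorrespondence

variable {W Z Y V₁ V₂ : Type*} [TopologicalSpace W] [TopologicalSpace Z] [TopologicalSpace Y]
  [AddCommGroup V₁] [Module ℂ V₁] [AddCommGroup V₂] [Module ℂ V₂]
  (Q : PreCorrespondence W Z V₁) (P : PreCorrespondence Z Y V₂)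

/-- The inner product on the algebraic tensor product,
`(x₁ ⊗ y₁ ∣ x₂ ⊗ y₂) = (y₁ ∣ (x₁ ∣ x₂) · y₂)`. -/
noncomputable def tensorIp : V₁ ⊗[ℂ] V₂ →ₗ⋆[ℂ] V₁ ⊗[ℂ] V₂ →ₗ[ℂ] C₀(Y, ℂ) :=
  TensorProduct.lift (LinearMap.mk₂'ₛₗ (starRingEnd ℂ) (starRingEnd ℂ)
    (fun x y => TensorProduct.lift ((P.left ∘ₗ Q.ip x).compr₂ (P.ip y)))
    (fun x x' y => TensorProduct.ext' fun x₂ y₂ => by simp)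
    (fun c x y => TensorProduct.ext' fun x₂ y₂ => by simp)
    (fun x y y' => TensorProduct.ext' fun x₂ y₂ => by simp)
    (fun c x y => TensorProduct.ext' fun x₂ y₂ => by simp))

theorem tensorIp_tmul (x₁ x₂ : V₁) (y₁ y₂ : V₂) :
    Q.tensorIp P (x₁ ⊗ₜ y₁) (x₂ ⊗ₜ y₂) = P.ip y₁ (P.left (Q.ip x₁ x₂) y₂) := rfl

theorem tensorIp_nonneg (ξ : V₁ ⊗[ℂ] V₂) (u : Y) : 0 ≤ Q.tensorIp P ξ ξ u := by
  classical
  obtain ⟨S, rfl⟩ := TensorProduct.exists_finset ξ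
  rw [← Finset.sum_coe_sort]
  obtain ⟨s, hs⟩ := exists_sqrt_of_posSemidef (fun i j : S => Q.ip i.1.1 j.1.1) (fun z => by
    refine Matrix.PosSemidef.of_dotProduct_mulVec_nonneg ?_ ?_
    · ext i j
      exact Q.ip_star_apply _ _ _
    · intro c
      have h := Q.ip_nonneg (∑ i, c i • i.1.1) z
      have h4 : ∀ F : S → C₀(Z, ℂ), (∑ k, F k) z = ∑ k, F k z := fun F =>
        map_sum (AddMonoidHom.mk' (fun f : C₀(Z, ℂ) => f z) fun _ _ => rfl) F Finset.univ
      convert h using 1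
      simp only [map_sum, LinearMap.sum_apply, h4, map_smulₛₗ, LinearMap.smul_apply,
        ZeroAtInftyContinuousMap.smul_apply, dotProduct, Matrix.mulVec, Matrix.of_apply,
        Finset.mul_sum, RingHom.id_apply, smul_eq_mul, Pi.star_apply, RCLike.star_def]
      rw [Finset.sum_comm]
      refine Finset.sum_congr rfl fun i _ => Finset.sum_congr rfl fun j _ => ?_
      ring)
  have key : Q.tensorIp P (∑ i : S, i.1.1 ⊗ₜ i.1.2) (∑ i : S, i.1.1 ⊗ₜ i.1.2)
      = ∑ k, P.ip (∑ i : S, P.left (s k i) i.1.2) (∑ i : S, P.left (s k i) i.1.2) := by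
    simp only [map_sum, LinearMap.sum_apply, tensorIp_tmul, hs, P.ip_left, P.left_mul]
    exact (Finset.sum_congr rfl fun _ _ => Finset.sum_comm).trans Finset.sum_comm
  rw [key]
  have h4 : ∀ F : S → C₀(Y, ℂ), (∑ k, F k) u = ∑ k, F k u := fun F =>
    map_sum (AddMonoidHom.mk' (fun f : C₀(Y, ℂ) => f u) fun _ _ => rfl) F Finset.univ
  rw [h4]
  exact Finset.sum_nonneg fun k _ => P.ip_nonneg _ u

/-- The algebraic tensor product of two pre-correspondences. -/
noncomputable def algTensor : PreCorrespondence W Y (V₁ ⊗[ℂ] V₂) where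
  left := LinearMap.rTensorHom V₂ ∘ₗ Q.left
  right := LinearMap.lTensorHom V₁ ∘ₗ P.right
  ip := Q.tensorIp P
  ip_star x y := by
    induction x with
    | zero => simp
    | add x x' h h' => simp [h, h']
    | tmul x₁ y₁ =>
      induction y with
      | zero => simp
      | add y y' h h' => simp [h, h']
      | tmul x₂ y₂ =>
        rw [tensorIp_tmul, tensorIp_tmul, P.ip_star, P.ip_left, Q.ip_star]
  ip_nonneg := Q.tensorIp_nonneg P
  ip_right x y b := by
    induction x with
    | zero => simp
    | add x x' h h' => rw [map_add, LinearMap.add_apply, LinearMap.add_apply, h, h', add_mul]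
    | tmul x₁ y₁ =>
      induction y with
      | zero => simp
      | add y y' h h' => rw [map_add, map_add, map_add, h, h', add_mul]
      | tmul x₂ y₂ =>
        change Q.tensorIp P (x₁ ⊗ₜ y₁) (x₂ ⊗ₜ P.right b y₂) = _
        rw [tensorIp_tmul, tensorIp_tmul, P.left_right, P.ip_right]
  right_mul b c x := by
    induction x with
    | zero => simp
    | add x x' h h' => rw [map_add, map_add, map_add, h, h']
    | tmul x y =>
      change x ⊗ₜ P.right (b * c) y = x ⊗ₜ[ℂ] P.right c (P.right b y)
      rw [P.right_mul]
  left_mul a c x := by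
    induction x with
    | zero => simp
    | add x x' h h' => rw [map_add, map_add, map_add, h, h']
    | tmul x y =>
      change Q.left (a * c) x ⊗ₜ y = Q.left a (Q.left c x) ⊗ₜ[ℂ] y
      rw [Q.left_mul]
  ip_left a x y := by
    induction x with
    | zero => simp
    | add x x' h h' => simp only [map_add, LinearMap.add_apply, h, h']
    | tmul x₁ y₁ =>
      induction y with
      | zero => simp
      | add y y' h h' => rw [map_add, map_add, map_add, h, h']
      | tmul x₂ y₂ =>
        change Q.tensorIp P (Q.left a x₁ ⊗ₜ y₁) (x₂ ⊗ₜ y₂)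
          = Q.tensorIp P (x₁ ⊗ₜ y₁) (Q.left (star a) x₂ ⊗ₜ y₂)
        rw [tensorIp_tmul, tensorIp_tmul, Q.ip_left]
  left_right a b x := by
    induction x with
    | zero => simp
    | add x x' h h' => rw [map_add, map_add, map_add, map_add, h, h']
    | tmul x y => rfl

/-- The interior tensor product of a `C₀(W)`-`C₀(Z)`-correspondence and a
`C₀(Z)`-`C₀(Y)`-correspondence: the completion of the algebraic tensor product in the inner product
`(x₁ ⊗ y₁ ∣ x₂ ⊗ y₂) = (y₁ ∣ (x₁ ∣ x₂) · y₂)`, modulo the vectors of length zero (these include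
all `(x · a) ⊗ y - x ⊗ (a · y)`). -/
noncomputable def tensor : Correspondence W Y (Completion (Q.algTensor P).Carrier) :=
  (Q.algTensor P).completion

end PreCorrespondence

section FibreSum

variable {M Y : Type*} [TopologicalSpace M] [TopologicalSpace Y]

/-- The function `y ↦ ∑ f e` over the fibre `s e = y`. -/
noncomputable def fibreSumFun {M Y : Type*} (s : M → Y) (f : M → ℂ) (y : Y) : ℂ := ∑ᶠ e ∈ s ⁻¹' {y}, f e

theorem finite_compact_inter_fibre [T2Space Y] {s : M → Y} (hs : IsLocalHomeomorph s) {K : Set M}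
    (hK : IsCompact K) (y : Y) : (K ∩ s ⁻¹' {y}).Finite := by
  refine (hK.inter_right (isClosed_singleton.preimage hs.continuous)).finite ?_
  refine (hs.isLocalHomeomorphOn.mono (Set.subset_univ _)).isDiscrete_of_image ?_
  have h : (s '' (K ∩ s ⁻¹' {y})).Subsingleton := by
    rintro _ ⟨a, ⟨-, ha⟩, rfl⟩ _ ⟨b, ⟨-, hb⟩, rfl⟩
    exact (Set.mem_singleton_iff.1 ha).trans (Set.mem_singleton_iff.1 hb).symm
  exact h.isDiscrete

theorem fibreSumFun_eq_sum {M Y : Type*} {s : M → Y} {K : Set M} {y : Y} (hK : (K ∩ s ⁻¹' {y}).Finite)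
    {f : M → ℂ} (hf : ∀ e, e ∉ K → f e = 0) : fibreSumFun s f y = ∑ e ∈ hK.toFinset, f e := by
  refine finsum_mem_eq_sum_of_inter_support_eq f ?_
  ext e
  simp only [Set.mem_inter_iff, Set.mem_preimage, Set.mem_singleton_iff, Function.mem_support,
    Set.Finite.coe_toFinset]
  refine ⟨fun h => ⟨⟨?_, h.1⟩, h.2⟩, fun h => ⟨h.1.2, h.2⟩⟩
  by_contra hc
  exact h.2 (hf e hc)

theorem fibreSumFun_eq_zero {M Y : Type*} {s : M → Y} {f : M → ℂ} {y : Y} (h : ∀ e, s e = y → f e = 0) :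
    fibreSumFun s f y = 0 :=
  finsum_mem_of_eqOn_zero fun e he => h e he

/-- Continuity of the sum over the fibres, for a function supported where `s` is a chart. -/
theorem continuous_fibreSumFun_of_chart [T2Space Y] {s : M → Y} (hs : Continuous s)
    (e : OpenPartialHomeomorph M Y) (he : s = e) {g : M → ℂ} (hg : Continuous g) {K : Set M}
    (hK : IsCompact K) (hKe : K ⊆ e.source) (hgK : ∀ x, x ∉ K → g x = 0) :
    Continuous (fibreSumFun s g) := by
  subst he
  have h1 : ∀ y ∈ e.target, fibreSumFun e g y = g (e.symm y) := by
    intro y hy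
    have hfin : (K ∩ e ⁻¹' {y}) ⊆ {e.symm y} := by
      rintro x ⟨hxK, hxy⟩
      rw [Set.mem_singleton_iff, ← Set.mem_singleton_iff.1 hxy, e.left_inv (hKe hxK)]
    rw [fibreSumFun_eq_sum ((Set.finite_singleton _).subset hfin) hgK]
    by_cases hx : e.symm y ∈ K
    · rw [Finset.sum_eq_single (e.symm y)]
      · intro b hb hne
        exact absurd (hfin (by simpa using hb)) hne
      · intro hn
        exact absurd (by rw [Set.Finite.mem_toFinset]; exact ⟨hx, e.right_inv hy⟩) hn
    · rw [hgK _ hx]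
      refine Finset.sum_eq_zero fun b hb => ?_
      have hb' := (Set.Finite.mem_toFinset _).1 hb
      have := hfin hb'
      rw [Set.mem_singleton_iff] at this
      exact absurd (this ▸ hb'.1) hx
  rw [continuous_iff_continuousAt]
  intro y
  by_cases hy : y ∈ e.target
  · have h2 : ContinuousAt (fun y => g (e.symm y)) y :=
      hg.continuousAt.comp (e.continuousAt_symm hy)
    refine h2.congr ?_
    filter_upwards [e.open_target.mem_nhds hy] with z hz
    exact (h1 z hz).symm
  · have hcl : IsClosed (e '' K) := (hK.image hs).isClosed
    have hyK : y ∈ (e '' K)ᶜ := by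
      rintro ⟨x, hx, rfl⟩
      exact hy (e.map_source (hKe hx))
    refine (continuousAt_const (y := (0 : ℂ))).congr ?_
    filter_upwards [hcl.isOpen_compl.mem_nhds hyK] with z hz
    refine (fibreSumFun_eq_zero fun x hx => hgK x fun hxK => hz ⟨x, hxK, hx⟩).symm

theorem continuous_fibreSumFun [T2Space M] [LocallyCompactSpace M] [T2Space Y] {s : M → Y}
    (hs : IsLocalHomeomorph s) {f : M → ℂ} (hf : Continuous f) {K : Set M} (hK : IsCompact K)
    (hfK : ∀ x, x ∉ K → f x = 0) : Continuous (fibreSumFun s f) := by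
  choose e hxe hse using hs
  obtain ⟨t, -, ht⟩ := hK.elim_nhds_subcover (fun x => (e x).source)
    fun x _ => (e x).open_source.mem_nhds (hxe x)
  obtain ⟨ρ, hρs, hρ1, -, hρc⟩ := exists_continuous_sum_one_of_isOpen_isCompact
    (n := t.card) (s := fun i => (e (t.equivFin.symm i)).source) (t := K)
    (fun i => (e _).open_source) hK (by
      intro x hx
      obtain ⟨z, hz, hxz⟩ := Set.mem_iUnion₂.1 (ht hx)
      exact Set.mem_iUnion.2 ⟨t.equivFin ⟨z, hz⟩, by simpa using hxz⟩)
  have hs' : IsLocalHomeomorph s := fun x => ⟨e x, hxe x, hse x⟩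
  have hsum : fibreSumFun s f = fun y => ∑ i, fibreSumFun s (fun x => (ρ i x : ℂ) * f x) y := by
    funext y
    have hfin := finite_compact_inter_fibre hs' hK y
    rw [fibreSumFun_eq_sum hfin hfK, Finset.sum_congr rfl fun i _ => fibreSumFun_eq_sum hfin
      (f := fun x => (ρ i x : ℂ) * f x) (fun x hx => by simp [hfK x hx]), Finset.sum_comm]
    refine Finset.sum_congr rfl fun x hx => ?_
    have hxK : x ∈ K := ((Set.Finite.mem_toFinset _).1 hx).1
    have h1 : ∑ i, ρ i x = 1 := by simpa using hρ1 hxK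
    rw [← Finset.sum_mul, ← Complex.ofReal_sum, h1, Complex.ofReal_one, one_mul]
  rw [hsum]
  refine continuous_finsetSum _ fun i _ => ?_
  refine continuous_fibreSumFun_of_chart hs'.continuous (e _) (hse (t.equivFin.symm i))
    (by fun_prop) (hρc i) (hρs i) fun x hx => ?_
  rw [image_eq_zero_of_notMem_tsupport hx]
  simp

/-- For a local homeomorphism `s : M → Y`, the linear map `C_c(M) → C_c(Y)` that sends `f` to the
function `y ↦ ∑ f e` over the fibre `s e = y`. -/
noncomputable def fibreSum [T2Space M] [LocallyCompactSpace M] [T2Space Y] (s : M → Y)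
    (hs : IsLocalHomeomorph s) : C_c(M, ℂ) →ₗ[ℂ] C_c(Y, ℂ) where
  toFun f := ⟨⟨fibreSumFun s f, continuous_fibreSumFun hs (map_continuous f) f.hasCompactSupport
      fun _ hx => image_eq_zero_of_notMem_tsupport hx⟩,
    HasCompactSupport.intro (f.hasCompactSupport.isCompact.image hs.continuous) fun _ hy =>
      fibreSumFun_eq_zero fun e he => image_eq_zero_of_notMem_tsupport fun h => hy ⟨e, h, he⟩⟩
  map_add' f g := by
    ext y
    have hc : IsCompact (tsupport f ∪ tsupport g) :=
      f.hasCompactSupport.isCompact.union g.hasCompactSupport.isCompact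
    have hfin := finite_compact_inter_fibre hs hc y
    have hf : ∀ e, e ∉ tsupport f ∪ tsupport g → f e = 0 := fun e he =>
      image_eq_zero_of_notMem_tsupport fun h => he (Or.inl h)
    have hg : ∀ e, e ∉ tsupport f ∪ tsupport g → g e = 0 := fun e he =>
      image_eq_zero_of_notMem_tsupport fun h => he (Or.inr h)
    change fibreSumFun s (f + g : C_c(M, ℂ)) y = fibreSumFun s f y + fibreSumFun s g y
    rw [fibreSumFun_eq_sum hfin hf, fibreSumFun_eq_sum hfin hg, fibreSumFun_eq_sum hfin
      (f := (f + g : C_c(M, ℂ))) (fun e he => by simp [hf e he, hg e he]), ← Finset.sum_add_distrib]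
    rfl
  map_smul' c f := by
    ext y
    have hfin := finite_compact_inter_fibre hs f.hasCompactSupport.isCompact y
    have hf : ∀ e, e ∉ tsupport f → f e = 0 := fun e he => image_eq_zero_of_notMem_tsupport he
    change fibreSumFun s (c • f : C_c(M, ℂ)) y = c * fibreSumFun s f y
    rw [fibreSumFun_eq_sum hfin hf, fibreSumFun_eq_sum hfin (f := (c • f : C_c(M, ℂ)))
      (fun e he => by simp [hf e he]), Finset.mul_sum]
    rfl

theorem fibreSum_apply [T2Space M] [LocallyCompactSpace M] [T2Space Y] (s : M → Y)
    (hs : IsLocalHomeomorph s) (f : C_c(M, ℂ)) (y : Y) :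
    fibreSum s hs f y = ∑ᶠ e ∈ s ⁻¹' {y}, f e := rfl

theorem fibreSum_nonneg [T2Space M] [LocallyCompactSpace M] [T2Space Y] (s : M → Y)
    (hs : IsLocalHomeomorph s) (f : C_c(M, ℂ)) (hf : ∀ e, 0 ≤ f e) (y : Y) :
    0 ≤ fibreSum s hs f y :=
  finsum_mem_induction (fun z : ℂ => 0 ≤ z) le_rfl (fun _ _ => add_nonneg) fun e _ => hf e

/-- Multiplication of `x ∈ C_c(M)` by `b ∘ s`, for `b ∈ C₀(Y)` and a continuous `s : M → Y`. -/
noncomputable def pullbackMul (s : C(M, Y)) : C₀(Y, ℂ) →ₗ[ℂ] C_c(M, ℂ) →ₗ[ℂ] C_c(M, ℂ) :=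
  LinearMap.mk₂ ℂ (fun b x => (b : C(Y, ℂ)).comp s • x)
    (fun b c x => by ext e; exact add_mul _ _ _)
    (fun k b x => by ext e; exact mul_assoc _ _ _)
    (fun b x y => by ext e; exact mul_add _ _ _)
    (fun k b x => by ext e; exact mul_left_comm _ _ _)

theorem pullbackMul_apply (s : C(M, Y)) (b : C₀(Y, ℂ)) (x : C_c(M, ℂ)) (e : M) :
    pullbackMul s b x e = b (s e) * x e := rfl

/-- The inner product `(x ∣ y)(v) = ∑ conj (x e) * y e` over the fibre `s e = v`. -/
noncomputable def fibreIp [T2Space M] [LocallyCompactSpace M] [T2Space Y] (s : M → Y)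
    (hs : IsLocalHomeomorph s) : C_c(M, ℂ) →ₗ⋆[ℂ] C_c(M, ℂ) →ₗ[ℂ] C₀(Y, ℂ) :=
  LinearMap.mk₂'ₛₗ (starRingEnd ℂ) (RingHom.id ℂ)
    (fun x y => (fibreSum s hs (star x * y) : C₀(Y, ℂ)))
    (fun x x' y => by rw [star_add, add_mul, map_add]; rfl)
    (fun c x y => by rw [star_smul, smul_mul_assoc, map_smul]; rfl)
    (fun x y y' => by rw [mul_add, map_add]; rfl)
    (fun c x y => by rw [mul_smul_comm, map_smul]; rfl)

theorem fibreIp_apply [T2Space M] [LocallyCompactSpace M] [T2Space Y] (s : M → Y)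
    (hs : IsLocalHomeomorph s) (x y : C_c(M, ℂ)) (v : Y) :
    fibreIp s hs x y v = ∑ᶠ e ∈ s ⁻¹' {v}, conj (x e) * y e := rfl

/-- For a continuous map `r : M → W` and a local homeomorphism `s : M → Y`, the
pre-correspondence `C_c(M)` with the operations `(a · x)(e) = a (r e) * x e`,
`(x · b)(e) = x e * b (s e)` and `(x ∣ y)(v) = ∑ conj (x e) * y e` over the fibre `s e = v`. -/
noncomputable def fibrePreCorrespondence {W : Type*} [TopologicalSpace W] [T2Space M]
    [LocallyCompactSpace M] [T2Space Y] (r : M → W) (hr : Continuous r) (s : M → Y)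
    (hs : IsLocalHomeomorph s) : PreCorrespondence W Y C_c(M, ℂ) where
  left := pullbackMul ⟨r, hr⟩
  right := pullbackMul ⟨s, hs.continuous⟩
  ip := fibreIp s hs
  ip_star x y := by
    ext v
    change conj (fibreIp s hs x y v) = fibreIp s hs y x v
    have hfin := finite_compact_inter_fibre hs x.hasCompactSupport.isCompact v
    have hx : ∀ e, e ∉ tsupport x → x e = 0 := fun e he => image_eq_zero_of_notMem_tsupport he
    change conj (fibreSumFun s (fun e => conj (x e) * y e) v)
      = fibreSumFun s (fun e => conj (y e) * x e) v
    rw [fibreSumFun_eq_sum hfin (by simp +contextual [hx]),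
      fibreSumFun_eq_sum hfin (by simp +contextual [hx]), map_sum]
    simp [mul_comm]
  ip_nonneg x v := fibreSum_nonneg s hs (star x * x) (fun e => star_mul_self_nonneg (x e)) v
  ip_right x y b := by
    ext v
    have hfin := finite_compact_inter_fibre hs x.hasCompactSupport.isCompact v
    have hx : ∀ e, e ∉ tsupport x → x e = 0 := fun e he => image_eq_zero_of_notMem_tsupport he
    change fibreSumFun s (fun e => conj (x e) * (b (s e) * y e)) v
      = fibreSumFun s (fun e => conj (x e) * y e) v * b v
    rw [fibreSumFun_eq_sum hfin (by simp +contextual [hx]),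
      fibreSumFun_eq_sum hfin (by simp +contextual [hx]), Finset.sum_mul]
    refine Finset.sum_congr rfl fun e he => ?_
    have : s e = v := ((Set.Finite.mem_toFinset _).1 he).2
    rw [this]
    ring
  right_mul b c x := by ext e; simp only [pullbackMul_apply, ZeroAtInftyContinuousMap.mul_apply]; ring
  left_mul a c x := by ext e; simp only [pullbackMul_apply, ZeroAtInftyContinuousMap.mul_apply]; ring
  ip_left a x y := by
    ext v
    refine congrArg (fun f => fibreSumFun s f v) (funext fun e => ?_)
    change conj (a (r e) * x e) * y e = conj (x e) * (conj (a (r e)) * y e)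
    rw [map_mul]
    ring
  left_right a b x := by ext e; simp only [pullbackMul_apply]; ring

end FibreSum

universe u v w

set_option linter.checkUnivs false in
/-- A topological graph: second countable locally compact Hausdorff spaces `V` of vertices and `E` of
edges, a continuous range map `r` and a source map `s` which is a local homeomorphism. -/
structure TopologicalGraph where
  V : Type u
  E : Type v
  [topV : TopologicalSpace V]
  [t2V : T2Space V]
  [lcV : LocallyCompactSpace V]
  [scV : SecondCountableTopology V]
  [topE : TopologicalSpace E]
  [t2E : T2Space E]
  [lcE : LocallyCompactSpace E]
  [scE : SecondCountableTopology E]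
  r : E → V
  s : E → V
  continuous_r : Continuous r
  isLocalHomeomorph_s : IsLocalHomeomorph s

namespace TopologicalGraph

attribute [instance] topV t2V lcV scV topE t2E lcE scE

section Regular

variable {X Y : Type*} [TopologicalSpace X] [TopologicalSpace Y] (f : X → Y)

/-- the `f`-sources -/
def sourceSet : Set Y := (closure (Set.range f))ᶜ

/-- the `f`-finite receivers -/
def finiteSet : Set Y :=
  {y | ∃ U, IsOpen U ∧ y ∈ U ∧ IsCompact (closure U) ∧ IsCompact (f ⁻¹' closure U)}

/-- the `f`-regular set -/
def regularSet : Set Y := finiteSet f \ closure (sourceSet f)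

/-- the `f`-singular set -/
def singularSet : Set Y := (regularSet f)ᶜ

end Regular

/-- A topological graph is regular if its set of singular vertices (with respect to the range map) is
empty. -/
def IsRegular (G : TopologicalGraph.{u, v}) : Prop := singularSet G.r = ∅

variable (G : TopologicalGraph.{u, v})

/-- The `C₀(V)`-`C₀(V)`-pre-correspondence `C_c(E)` of a topological graph. -/
noncomputable def preCorrespondence : PreCorrespondence G.V G.V C_c(G.E, ℂ) :=
  fibrePreCorrespondence G.r G.continuous_r G.s G.isLocalHomeomorph_s

/-- The underlying space of the graph correspondence: the completion of `C_c(E)`. -/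
abbrev GraphModule := Completion G.preCorrespondence.Carrier

/-- The canonical map from `C_c(E)` to the graph correspondence. -/
noncomputable abbrev ι : C_c(G.E, ℂ) →ₗ[ℂ] G.GraphModule := G.preCorrespondence.ι

/-- The graph correspondence of a topological graph. -/
noncomputable def correspondence : Correspondence G.V G.V G.GraphModule :=
  G.preCorrespondence.completion

end TopologicalGraph

/-- An out-split of a topological graph: a factorisation `s = α ∘ ψ` of the source map through a locally
compact Hausdorff space `Y`, by proper surjective local homeomorphisms `α` and `ψ`. -/
structure OutSplit (G : TopologicalGraph.{u, v}) where
  Y : Type w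
  [topY : TopologicalSpace Y]
  [t2Y : T2Space Y]
  [lcY : LocallyCompactSpace Y]
  α : Y → G.V
  isProperMap_α : IsProperMap α
  surjective_α : Function.Surjective α
  isLocalHomeomorph_α : IsLocalHomeomorph α
  ψ : G.E → Y
  isProperMap_ψ : IsProperMap ψ
  surjective_ψ : Function.Surjective ψ
  isLocalHomeomorph_ψ : IsLocalHomeomorph ψ
  comp_eq : α ∘ ψ = G.s

namespace OutSplit

attribute [instance] topY t2Y lcY

variable {G : TopologicalGraph.{u, v}} (O : OutSplit.{u, v, w} G)

instance : SecondCountableTopology O.Y :=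
  (O.isLocalHomeomorph_ψ.isOpenMap.isQuotientMap O.isLocalHomeomorph_ψ.continuous
    O.surjective_ψ).secondCountableTopology O.isLocalHomeomorph_ψ.isOpenMap

/-- The fibred product of `Y` and the edge space over `α` and the range map. -/
abbrev EdgeSpace := {p : O.Y × G.E // O.α p.1 = G.r p.2}

instance : LocallyCompactSpace O.EdgeSpace :=
  (isClosed_eq (O.isLocalHomeomorph_α.continuous.comp continuous_fst)
    (G.continuous_r.comp continuous_snd)).isClosedEmbedding_subtypeVal.locallyCompactSpace

instance : SecondCountableTopology O.EdgeSpace :=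
  TopologicalSpace.Subtype.secondCountableTopology _

theorem isLocalHomeomorph_snd : IsLocalHomeomorph fun p : O.EdgeSpace => p.1.2 := by
  have hcont : Continuous fun p : O.EdgeSpace => p.1.2 := by fun_prop
  have hopen : IsOpenMap fun p : O.EdgeSpace => p.1.2 := by
    refine IsOpenMap.of_nhds_le fun p N hN => ?_
    obtain ⟨T, hT, hTN⟩ := (mem_nhds_induced _ _ _).1 (Filter.mem_map.1 hN)
    obtain ⟨A, hA, B, hB, hAB⟩ := mem_nhds_prod_iff.1 hT
    have hr : G.r ⁻¹' (O.α '' A) ∈ nhds p.1.2 := by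
      refine G.continuous_r.continuousAt ?_
      rw [← p.2]
      exact O.isLocalHomeomorph_α.isOpenMap.image_mem_nhds hA
    filter_upwards [hr, hB] with e he heB
    obtain ⟨y, hy, hye⟩ := he
    exact hTN (a := ⟨(y, e), hye⟩) (hAB ⟨hy, heB⟩)
  rw [isLocalHomeomorph_iff_isOpenEmbedding_restrict]
  intro p
  obtain ⟨c, hc, hαc⟩ := O.isLocalHomeomorph_α p.1.1
  have hU : IsOpen {q : O.EdgeSpace | q.1.1 ∈ c.source} := c.open_source.preimage (by fun_prop)
  refine ⟨{q : O.EdgeSpace | q.1.1 ∈ c.source}, hU.mem_nhds hc,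
    Topology.IsOpenEmbedding.of_continuous_injective_isOpenMap
      (hcont.comp continuous_subtype_val) ?_ (hopen.domRestrict hU)⟩
  rintro ⟨⟨⟨y, e⟩, hq⟩, hy⟩ ⟨⟨⟨y', e'⟩, hq'⟩, hy'⟩ h
  have he : e = e' := h
  subst he
  have : y = y' := c.injOn hy hy' (by rw [← hαc]; exact hq.trans hq'.symm)
  subst this
  rfl

/-- The out-split graph: vertex space `Y`, edge space the fibred product `Y ×_{α, r} E`, range map
`(y, e) ↦ y` and source map `(y, e) ↦ ψ e`. -/
def graph : TopologicalGraph.{w, max v w} where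
  V := O.Y
  E := O.EdgeSpace
  r p := p.1.1
  s p := O.ψ p.1.2
  continuous_r := by fun_prop
  isLocalHomeomorph_s := O.isLocalHomeomorph_ψ.comp O.isLocalHomeomorph_snd

/-- The map `Λ : C_c(Y) → C_c(V)`, `Λ b v = ∑ b u` over the fibre `α u = v`. -/
noncomputable def expectation : C_c(O.Y, ℂ) →ₗ[ℂ] C_c(G.V, ℂ) :=
  fibreSum O.α O.isLocalHomeomorph_α

/-- The `C₀(Y)`-`C₀(V)`-pre-correspondence `C_c(Y)` with left multiplication, right action
`b · a = b * (a ∘ α)` and inner product `(b ∣ c) = Λ (star b * c)`. -/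
noncomputable def expectationPre : PreCorrespondence O.Y G.V C_c(O.Y, ℂ) :=
  fibrePreCorrespondence id continuous_id O.α O.isLocalHomeomorph_α

theorem expectationPre_left (b : C₀(O.Y, ℂ)) (c : C_c(O.Y, ℂ)) :
    O.expectationPre.left b c = b • c := rfl

theorem expectationPre_ip (b c : C_c(O.Y, ℂ)) :
    O.expectationPre.ip b c = (O.expectation (star b * c) : C₀(G.V, ℂ)) := rfl

/-- The correspondence `B^Λ`, where `B = C₀(Y)`. -/
noncomputable def expectationModule :
    Correspondence O.Y G.V (Completion O.expectationPre.Carrier) :=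
  O.expectationPre.completion

/-- The fibres of `α` have uniformly bounded cardinality. -/
def HasBoundedFibres : Prop := ∃ N : ℕ, ∀ v, (O.α ⁻¹' {v}).ncard ≤ N

end OutSplit

/-! ### Finite fibres and sums over them. -/

section FiniteFibres

variable {M Y : Type*} [TopologicalSpace M] [TopologicalSpace Y]

/-! Write `A = C₀(G.V)` and `B = C₀(O.Y)`. Proper local homeomorphisms have finite fibres, so `s = α
∘ ψ` splits a sum over an `s`-fibre into finitely many sums over `ψ`-fibres. On `C_c(E)` this says
that summing `(x ∣ y)_B` over the `α`-fibre of `v` gives `(x ∣ y)_A v` (`finsum_psiPre_ip`). All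
terms are nonnegative for `x = y`, hence the `B`-norm is at most the `A`-norm, and the identity of
`C_c(E)` extends to a contraction `toPsi` from `X(E)` to the completion for the `B`-norm. The
`B`-valued product on `X(E)` is pulled back along `toPsi`. The fibre identity survives in the limit,
because at a fixed `v` it involves finitely many point evaluations, and it makes the pulled-back
product definite. The right action of `B` is obtained by regarding `C_c(E)` as a
`B`-`A`-pre-correspondence with `B` acting from the left along `ψ`: adjointability for the
`A`-valued product makes the action bounded.

For the tensor product, `C_c(Y) ⊗ C_c(E)` is mapped both into `B^Λ ⊗_A X(E)` and into `C_c` of the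
edge space of the out-split graph, the latter by `b ⊗ x ↦ ((w, e) ↦ b w * x e)`. Both images are
dense in the completions (`denseRange_tensorMap`, `mulMap_surjective`), and the inner products agree
(`tensorPre_ip_tensorMap`): the edges `(w, e)` with source `u` are the pairs with `ψ e = u` and `α w
= r e`, so the sum over them is an iterated one, with `Λ` as the inner sum. An isometry between
dense images extends to the completions.

If every `α`-fibre has at most `N` points, then `‖Λ b‖ ≤ N ‖b‖`, the `A`-norm is at most `√N` times
the `B`-norm, and `C_c(Y) → B^Λ` is bounded by `√N` for the supremum norm. The last part follows by
extending from the dense subspace `C_c(Y)` of `B`. -/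

/-- A fibre is compact by properness and discrete because the map is locally injective. Finiteness
also keeps `finsum` and `Set.ncard` over fibres from falling back to their default value `0`. -/
theorem IsProperMap.finite_fibre [T2Space Y] {f : M → Y} (hp : IsProperMap f)
    (hl : IsLocalHomeomorph f) (y : Y) : (f ⁻¹' {y}).Finite := by
  simpa using finite_compact_inter_fibre hl
    (hp.isCompact_preimage (isCompact_singleton (x := y))) y

/-- The fibre of `g ∘ f` is a finite disjoint union of fibres of `f`. Applied to `s = α ∘ ψ` and to
the source map `ψ ∘ snd` of the out-split graph. -/
theorem finsum_mem_fibre_comp {M Y Z : Type*} {f : M → Y} {g : Y → Z} {z : Z}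
    (hg : (g ⁻¹' {z}).Finite) (hf : ∀ y, (f ⁻¹' {y}).Finite) (F : M → ℂ) :
    ∑ᶠ y ∈ g ⁻¹' {z}, ∑ᶠ e ∈ f ⁻¹' {y}, F e = ∑ᶠ e ∈ (g ∘ f) ⁻¹' {z}, F e := by
  rw [← finsum_mem_biUnion (fun a _ b _ hab => ?_) hg fun y _ => hf y]
  · congr 1
    ext e
    simp
  · exact Disjoint.preimage f (Set.disjoint_singleton.2 hab)

theorem le_finsum_mem_of_nonneg {Y : Type*} {S : Set Y} (hS : S.Finite) {f : Y → ℂ}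
    (hf : ∀ y, 0 ≤ f y) {y : Y} (hy : y ∈ S) : f y ≤ ∑ᶠ z ∈ S, f z := by
  rw [finsum_mem_eq_finite_toFinset_sum f hS]
  exact Finset.single_le_sum (fun z _ => hf z) (hS.mem_toFinset.2 hy)

/-- This lets identities between fibre sums pass from `C_c` to a completion without any uniform
bound on the fibres. -/
theorem continuous_finsum_mem {X Y : Type*} [TopologicalSpace X] {S : Set Y} (hS : S.Finite)
    {f : X → Y → ℂ} (hf : ∀ y, Continuous fun x => f x y) :
    Continuous fun x => ∑ᶠ y ∈ S, f x y := by
  simp_rw [fun x => finsum_mem_eq_finite_toFinset_sum (f x) hS]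
  exact continuous_finsetSum _ fun y _ => hf y

theorem norm_finsum_mem_le {Y : Type*} {S : Set Y} (hS : S.Finite) {N : ℕ} (hN : S.ncard ≤ N)
    {f : Y → ℂ} {C : ℝ} (hC : ∀ y, ‖f y‖ ≤ C) (hC0 : 0 ≤ C) : ‖∑ᶠ y ∈ S, f y‖ ≤ N * C := by
  rw [finsum_mem_eq_finite_toFinset_sum f hS]
  refine (norm_sum_le_of_le _ fun y _ => hC y).trans ?_
  rw [Finset.sum_const, nsmul_eq_mul, ← Set.ncard_eq_toFinset_card S hS]
  gcongr

end FiniteFibres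

/-! ### The `C₀(Y)`-valued structure on the graph correspondence. -/

namespace OutSplit

variable {G : TopologicalGraph.{u, v}} (O : OutSplit.{u, v, w} G)

theorem α_ψ (e : G.E) : O.α (O.ψ e) = G.s e := congrFun O.comp_eq e

theorem finite_fibre_α (y : G.V) : (O.α ⁻¹' {y}).Finite :=
  O.isProperMap_α.finite_fibre O.isLocalHomeomorph_α y

theorem finite_fibre_ψ (u : O.Y) : (O.ψ ⁻¹' {u}).Finite :=
  O.isProperMap_ψ.finite_fibre O.isLocalHomeomorph_ψ u

/-- The `*`-homomorphism `a ↦ a ∘ α`. -/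
noncomputable def pullback : C₀(G.V, ℂ) →⋆ₙₐ[ℂ] C₀(O.Y, ℂ) :=
  { ZeroAtInftyContinuousMap.compNonUnitalAlgHom
      (⟨⟨O.α, O.isProperMap_α.continuous⟩, (isProperMap_iff_tendsto_cocompact.1 O.isProperMap_α).2⟩ :
        CocompactMap O.Y G.V) with
    map_star' := fun _ => rfl }

theorem pullback_apply (a : C₀(G.V, ℂ)) (u : O.Y) : O.pullback a u = a (O.α u) := rfl

theorem pullback_injective : Function.Injective O.pullback := fun a b h => by
  ext v
  obtain ⟨u, rfl⟩ := O.surjective_α v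
  exact DFunLike.congr_fun h u

/-- The pre-correspondence `C_c(E)` with the operations along `r` and `ψ`. -/
noncomputable def psiPre : PreCorrespondence G.V O.Y C_c(G.E, ℂ) :=
  fibrePreCorrespondence G.r G.continuous_r O.ψ O.isLocalHomeomorph_ψ

/-- The pre-correspondence `C_c(E)` with the inner product along `s`, on which `C₀(Y)` acts
along `ψ`. -/
noncomputable def actPre : PreCorrespondence O.Y G.V C_c(G.E, ℂ) :=
  fibrePreCorrespondence O.ψ O.isLocalHomeomorph_ψ.continuous G.s G.isLocalHomeomorph_s

theorem psiPre_ip_apply (x y : C_c(G.E, ℂ)) (u : O.Y) :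
    O.psiPre.ip x y u = ∑ᶠ e ∈ O.ψ ⁻¹' {u}, conj (x e) * y e := rfl

theorem finsum_psiPre_ip (x y : C_c(G.E, ℂ)) (v : G.V) :
    ∑ᶠ u ∈ O.α ⁻¹' {v}, O.psiPre.ip x y u = G.preCorrespondence.ip x y v := by
  simp_rw [psiPre_ip_apply]
  rw [finsum_mem_fibre_comp (O.finite_fibre_α v) O.finite_fibre_ψ, O.comp_eq]
  rfl

/-- The value of `(x ∣ x)_B` at `u` is one of the nonnegative terms that add up to `(x ∣ x)_A` at `α
u`. -/
theorem norm_psiPre_ip_le (x : C_c(G.E, ℂ)) :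
    ‖O.psiPre.ip x x‖ ≤ ‖G.preCorrespondence.ip x x‖ := by
  refine PreCorrespondence.norm_le_of_forall _ (norm_nonneg _) fun u => ?_
  refine le_trans ?_ (PreCorrespondence.norm_apply_le _ (O.α u))
  refine CStarAlgebra.norm_le_norm_of_nonneg_of_le (O.psiPre.ip_nonneg x u) ?_
  rw [← O.finsum_psiPre_ip]
  exact le_finsum_mem_of_nonneg (O.finite_fibre_α _) (O.psiPre.ip_nonneg x) rfl

theorem norm_psiPre_ι_le (x : C_c(G.E, ℂ)) : ‖O.psiPre.ι x‖ ≤ 1 * ‖G.ι x‖ := by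
  rw [one_mul]
  refine le_of_sq_le_sq ?_ (norm_nonneg _)
  rw [PreCorrespondence.norm_sq_ι, PreCorrespondence.norm_sq_ι]
  exact O.norm_psiPre_ip_le x

/-- The canonical map from the graph correspondence to the completion of `C_c(E)` with respect to
the inner product along `ψ`. -/
noncomputable def toPsi : G.GraphModule →L[ℂ] Completion O.psiPre.Carrier :=
  O.psiPre.ι.extendOfNorm G.ι

theorem toPsi_ι (x : C_c(G.E, ℂ)) : O.toPsi (G.ι x) = O.psiPre.ι x :=
  LinearMap.extendOfNorm_eq G.preCorrespondence.denseRange_ι ⟨1, O.norm_psiPre_ι_le⟩ x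

theorem norm_toPsi_le (x : G.GraphModule) : ‖O.toPsi x‖ ≤ ‖x‖ := by
  have := LinearMap.norm_extendOfNorm_apply_le G.preCorrespondence.denseRange_ι 1
    O.norm_psiPre_ι_le x
  rwa [one_mul] at this

/-- The right action of `C₀(Y)` on the graph correspondence. -/
noncomputable def rightAct : C₀(O.Y, ℂ) →ₗ[ℂ] G.GraphModule →ₗ[ℂ] G.GraphModule :=
  -- `C₀(Y)` is commutative, so its right action may be built as a left action. In `actPre` the
  -- inner product is the `A`-valued one, so the completion is again `X(E)` and the general bound
  -- for left actions provides the extension.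
  O.actPre.completion.left

theorem rightAct_ι (b : C₀(O.Y, ℂ)) (x : C_c(G.E, ℂ)) :
    O.rightAct b (G.ι x) = G.ι (O.psiPre.right b x) := O.actPre.completion_left_ι b x

theorem continuous_rightAct (b : C₀(O.Y, ℂ)) : Continuous (O.rightAct b) :=
  O.actPre.continuous_leftC b

theorem continuous_left (a : C₀(G.V, ℂ)) : Continuous (G.correspondence.left a) :=
  G.preCorrespondence.continuous_leftC a

theorem left_ι (a : C₀(G.V, ℂ)) (x : C_c(G.E, ℂ)) :
    G.correspondence.left a (G.ι x) = G.ι (O.psiPre.left a x) :=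
  G.preCorrespondence.completion_left_ι a x

theorem toPsi_left (a : C₀(G.V, ℂ)) (x : G.GraphModule) :
    O.toPsi (G.correspondence.left a x) = O.psiPre.completion.left a (O.toPsi x) := by
  induction x using G.preCorrespondence.induction_ι with
  | hp =>
    exact isClosed_eq (O.toPsi.continuous.comp (continuous_left a))
      ((O.psiPre.continuous_leftC a).comp O.toPsi.continuous)
  | h x => rw [O.left_ι, toPsi_ι, toPsi_ι, PreCorrespondence.completion_left_ι]

theorem toPsi_rightAct (b : C₀(O.Y, ℂ)) (x : G.GraphModule) :
    O.toPsi (O.rightAct b x) = O.psiPre.completion.right b (O.toPsi x) := by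
  induction x using G.preCorrespondence.induction_ι with
  | hp =>
    exact isClosed_eq (O.toPsi.continuous.comp (O.continuous_rightAct b))
      ((O.psiPre.continuous_rightC b).comp O.toPsi.continuous)
  | h x => rw [O.rightAct_ι, toPsi_ι, toPsi_ι, PreCorrespondence.completion_right_ι]

/-- The `C₀(Y)`-valued structure on the graph correspondence `X(E)` given by an out-split. -/
noncomputable def splitPre : PreCorrespondence G.V O.Y G.GraphModule where
  left := G.correspondence.left
  right := O.rightAct
  -- Pulling back along `toPsi` keeps symmetry and positivity. The remaining axioms need only that
  -- `toPsi` intertwines the actions.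
  ip := (O.psiPre.completion.ip.comp (O.toPsi : G.GraphModule →ₗ[ℂ] _)).compl₂
    (O.toPsi : G.GraphModule →ₗ[ℂ] _)
  ip_star x y := O.psiPre.completion.ip_star (O.toPsi x) (O.toPsi y)
  ip_nonneg x := O.psiPre.completion.ip_nonneg (O.toPsi x)
  ip_right x y b := by
    have := O.psiPre.completion.ip_right (O.toPsi x) (O.toPsi y) b
    rwa [← O.toPsi_rightAct] at this
  right_mul b c x := by
    -- A left action composes in the opposite order to a right one; commutativity of `C₀(Y)`
    -- reconciles the two.
    rw [mul_comm]
    exact O.actPre.completion.left_mul c b x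
  left_mul := G.correspondence.left_mul
  ip_left a x y := by
    have := O.psiPre.completion.ip_left a (O.toPsi x) (O.toPsi y)
    rwa [← O.toPsi_left, ← O.toPsi_left] at this
  left_right a b x := by
    induction x using G.preCorrespondence.induction_ι with
    | hp =>
      exact isClosed_eq ((continuous_left a).comp (O.continuous_rightAct b))
        ((O.continuous_rightAct b).comp (continuous_left a))
    | h x => rw [O.rightAct_ι, O.left_ι, O.left_ι, O.rightAct_ι, O.psiPre.left_right]

theorem splitPre_ip (x y : G.GraphModule) :
    O.splitPre.ip x y = O.psiPre.ipC (O.toPsi x) (O.toPsi y) := rfl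

theorem splitPre_ip_ι (x y : C_c(G.E, ℂ)) :
    O.splitPre.ip (G.ι x) (G.ι y) = O.psiPre.ip x y := by
  rw [splitPre_ip, toPsi_ι, toPsi_ι, PreCorrespondence.ipC_ι]

theorem continuous_splitPre_ip {T : Type*} [TopologicalSpace T] {f g : T → G.GraphModule}
    (hf : Continuous f) (hg : Continuous g) : Continuous fun t => O.splitPre.ip (f t) (g t) :=
  O.psiPre.continuous_ipC (O.toPsi.continuous.comp hf) (O.toPsi.continuous.comp hg)

theorem norm_splitPre_ip_self (x : G.GraphModule) : ‖O.splitPre.ip x x‖ = ‖O.toPsi x‖ ^ 2 :=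
  (O.psiPre.completion.norm_sq (O.toPsi x)).symm

/-- For fixed `v` both sides are continuous in `(x, y)`, the left one being a finite sum of
evaluations, so `C_c(E)` suffices. -/
theorem finsum_splitPre_ip (x y : G.GraphModule) (v : G.V) :
    ∑ᶠ u ∈ O.α ⁻¹' {v}, O.splitPre.ip x y u = G.correspondence.ip x y v := by
  change _ = G.preCorrespondence.ipC x y v
  induction x, y using G.preCorrespondence.induction_ι₂ with
  | hp =>
    exact isClosed_eq
      (continuous_finsum_mem (O.finite_fibre_α v) fun u => (PreCorrespondence.continuous_eval u).comp
        (O.continuous_splitPre_ip continuous_fst continuous_snd))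
      ((PreCorrespondence.continuous_eval v).comp
        (G.preCorrespondence.continuous_ipC continuous_fst continuous_snd))
  | h x y => rw [splitPre_ip_ι, finsum_psiPre_ip, PreCorrespondence.ipC_ι]

/-- Summing over `α`-fibres turns `(x ∣ x)_B = 0` into `(x ∣ x)_A = 0`, and the `A`-valued product
defines the norm of `X(E)`. -/
theorem splitPre_definite (x : G.GraphModule) (h : O.splitPre.ip x x = 0) : x = 0 := by
  have h0 : G.correspondence.ip x x = 0 := by
    ext v
    rw [← O.finsum_splitPre_ip, h]
    exact finsum_mem_zero _
  have h1 := G.correspondence.norm_sq x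
  rw [h0, norm_zero] at h1
  exact norm_eq_zero.1 (pow_eq_zero_iff two_ne_zero |>.1 h1)

theorem splitPre_right_pullback (x : G.GraphModule) (a : C₀(G.V, ℂ)) :
    O.splitPre.right (O.pullback a) x = G.correspondence.right a x := by
  change O.rightAct (O.pullback a) x = G.preCorrespondence.rightC a x
  induction x using G.preCorrespondence.induction_ι with
  | hp =>
    exact isClosed_eq (O.continuous_rightAct _) (G.preCorrespondence.continuous_rightC a)
  | h x =>
    rw [O.rightAct_ι, PreCorrespondence.rightC_ι]
    congr 1
    ext e
    change O.pullback a (O.ψ e) * x e = a (G.s e) * x e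
    rw [pullback_apply, α_ψ]

end OutSplit

/-! ### A density criterion for isomorphism of completions. -/

namespace PreCorrespondence

/-- Two pre-correspondences into which a common space, with operators inducing the actions, maps with
dense range and the same inner products have isomorphic completions. -/
theorem completion_isIsomorphic_of_denseRange {W Y V V' D : Type*} [TopologicalSpace W]
    [TopologicalSpace Y] [AddCommGroup V] [Module ℂ V] [AddCommGroup V'] [Module ℂ V']
    [AddCommGroup D] [Module ℂ D] (T : PreCorrespondence W Y V) (Q : PreCorrespondence W Y V')
    (f : D →ₗ[ℂ] V) (g : D →ₗ[ℂ] V') (hf : DenseRange (T.ι ∘ₗ f)) (hg : DenseRange (Q.ι ∘ₗ g))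
    (hip : ∀ x y, T.ip (f x) (f y) = Q.ip (g x) (g y))
    (l : C₀(W, ℂ) → D → D) (r : C₀(Y, ℂ) → D → D)
    (hlf : ∀ a x, T.left a (f x) = f (l a x)) (hlg : ∀ a x, Q.left a (g x) = g (l a x))
    (hrf : ∀ b x, T.right b (f x) = f (r b x)) (hrg : ∀ b x, Q.right b (g x) = g (r b x)) :
    T.completion.IsIsomorphic Q.completion := by
  -- Neither map out of `D` has to be injective: equal seminorms force equal kernels after
  -- completion, and density on both sides makes the extended isometry bijective.
  have hnorm : ∀ x, ‖(Q.ι ∘ₗ g) (LinearEquiv.refl ℂ D x)‖ = ‖(T.ι ∘ₗ f) x‖ := fun x => by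
    refine (sq_eq_sq₀ (norm_nonneg _) (norm_nonneg _)).1 ?_
    change ‖Q.ι (g x)‖ ^ 2 = ‖T.ι (f x)‖ ^ 2
    rw [norm_sq_ι, norm_sq_ι, hip]
  let β := (LinearEquiv.refl ℂ D).extendOfIsometry (T.ι ∘ₗ f) (Q.ι ∘ₗ g) hf hg hnorm
  have hβ : ∀ x, β (T.ι (f x)) = Q.ι (g x) := fun x =>
    (LinearEquiv.refl ℂ D).extendOfIsometry_eq (T.ι ∘ₗ f) (Q.ι ∘ₗ g) hf hg hnorm x
  have hβc : Continuous β := β.continuous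
  refine ⟨β.toLinearEquiv, fun x y => ?_, fun x b => ?_, fun a x => ?_⟩
  · change Q.ipC (β x) (β y) = T.ipC x y
    refine hf.induction_on₂ (p := fun x y => Q.ipC (β x) (β y) = T.ipC x y) (isClosed_eq
      (Q.continuous_ipC (hβc.comp continuous_fst) (hβc.comp continuous_snd))
      (T.continuous_ipC continuous_fst continuous_snd)) (fun x y => ?_) x y
    change Q.ipC (β (T.ι (f x))) (β (T.ι (f y))) = T.ipC (T.ι (f x)) (T.ι (f y))
    rw [hβ, hβ, ipC_ι, ipC_ι, hip]
  · change β (T.rightC b x) = Q.rightC b (β x)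
    refine hf.induction_on x (isClosed_eq (hβc.comp (T.continuous_rightC b))
      ((Q.continuous_rightC b).comp hβc)) fun x => ?_
    change β (T.rightC b (T.ι (f x))) = Q.rightC b (β (T.ι (f x)))
    rw [rightC_ι, hrf, hβ, hβ, rightC_ι, hrg]
  · change β (T.leftC a x) = Q.leftC a (β x)
    refine hf.induction_on x (isClosed_eq (hβc.comp (T.continuous_leftC a))
      ((Q.continuous_leftC a).comp hβc)) fun x => ?_
    change β (T.leftC a (T.ι (f x))) = Q.leftC a (β (T.ι (f x)))
    rw [leftC_ι, hlf, hβ, hβ, leftC_ι, hlg]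

end PreCorrespondence

/-! ### The tensor product and the out-split graph. -/

namespace OutSplit

variable {G : TopologicalGraph.{u, v}} (O : OutSplit.{u, v, w} G)

/-- The algebraic tensor product of `B^Λ` and `X(E)`, before completion. -/
noncomputable def tensorPre : PreCorrespondence O.Y O.Y
    (Completion O.expectationPre.Carrier ⊗[ℂ] G.GraphModule) :=
  O.expectationModule.algTensor O.splitPre

/-- Cauchy–Schwarz and the bound on the left action by `(b ∣ b)_A`, followed by the comparison of
the `B`-norm with the `A`-norm. It gives continuity of `b ⊗ x` in each variable separately. -/
theorem norm_tensorPre_ι_tmul_le (b : Completion O.expectationPre.Carrier) (x : G.GraphModule) :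
    ‖O.tensorPre.ι (b ⊗ₜ x)‖ ≤ ‖b‖ * ‖x‖ := by
  refine le_of_sq_le_sq ?_ (by positivity)
  rw [PreCorrespondence.norm_sq_ι]
  change ‖O.splitPre.ip x (O.splitPre.left (O.expectationModule.ip b b) x)‖ ≤ _
  have h1 := O.splitPre.norm_ip_le x (O.splitPre.left (O.expectationModule.ip b b) x)
  have h2 := O.splitPre.norm_left_le (O.expectationModule.ip b b) x
  rw [PreCorrespondence.norm_toCarrier, PreCorrespondence.norm_toCarrier,
    ← O.expectationModule.norm_sq] at h2
  have h3 : √‖O.splitPre.ip x x‖ ≤ ‖x‖ := by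
    rw [norm_splitPre_ip_self, Real.sqrt_sq (norm_nonneg _)]
    exact O.norm_toPsi_le x
  calc _ ≤ _ := h1
    _ ≤ ‖x‖ * (‖b‖ ^ 2 * ‖x‖) := by gcongr; exact h2.trans (by gcongr)
    _ = _ := by ring

/-- The canonical map from the algebraic tensor product of `C_c(Y)` and `C_c(E)`. -/
noncomputable def tensorMap : C_c(O.Y, ℂ) ⊗[ℂ] C_c(G.E, ℂ) →ₗ[ℂ]
    Completion O.expectationPre.Carrier ⊗[ℂ] G.GraphModule :=
  TensorProduct.map O.expectationPre.ι G.ι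

theorem denseRange_tensorMap : DenseRange (O.tensorPre.ι ∘ₗ O.tensorMap) := by
  let S := (LinearMap.range (O.tensorPre.ι ∘ₗ O.tensorMap)).topologicalClosure
  have hS : IsClosed (S : Set (Completion O.tensorPre.Carrier)) :=
    Submodule.isClosed_topologicalClosure _
  have hb : ∀ b, Continuous fun x : G.GraphModule => O.tensorPre.ι (b ⊗ₜ x) := fun b =>
    ((O.tensorPre.ι ∘ₗ TensorProduct.mk ℂ _ _ b).mkContinuous ‖b‖
      (O.norm_tensorPre_ι_tmul_le b)).continuous
  have hx : ∀ x, Continuous fun b : Completion O.expectationPre.Carrier =>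
      O.tensorPre.ι (b ⊗ₜ x) := fun x =>
    ((O.tensorPre.ι ∘ₗ (TensorProduct.mk ℂ _ _).flip x).mkContinuous ‖x‖
      fun b => (O.norm_tensorPre_ι_tmul_le b x).trans_eq (mul_comm _ _)).continuous
  -- Separate continuity and closedness of `S` allow each factor in turn to be approximated by
  -- compactly supported functions.
  have hmem : ∀ b x, O.tensorPre.ι (b ⊗ₜ x) ∈ S := fun b x => by
    induction b using O.expectationPre.induction_ι with
    | hp => exact hS.preimage (hx x)
    | h b =>
      induction x using G.preCorrespondence.induction_ι with
      | hp => exact hS.preimage (hb _)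
      | h x => exact Submodule.le_topologicalClosure _ ⟨b ⊗ₜ x, rfl⟩
  intro z
  change z ∈ S
  induction z using O.tensorPre.induction_ι with
  | hp => exact hS
  | h t =>
    induction t with
    | zero => rw [map_zero]; exact S.zero_mem
    | add t t' h h' => rw [map_add]; exact S.add_mem h h'
    | tmul b x => exact hmem b x

/-! ### Elementary tensors as functions on the edge space. -/

theorem hasCompactSupport_mul (b : C_c(O.Y, ℂ)) (x : C_c(G.E, ℂ)) :
    HasCompactSupport fun p : O.EdgeSpace => b p.1.1 * x p.1.2 := by
  have hc : Topology.IsClosedEmbedding (Subtype.val : O.EdgeSpace → O.Y × G.E) :=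
    (isClosed_eq (O.isLocalHomeomorph_α.continuous.comp continuous_fst)
      (G.continuous_r.comp continuous_snd)).isClosedEmbedding_subtypeVal
  refine HasCompactSupport.intro (hc.isCompact_preimage
    (b.hasCompactSupport.isCompact.prod x.hasCompactSupport.isCompact)) fun p hp => ?_
  by_cases hb : p.1.1 ∈ tsupport b
  · rw [image_eq_zero_of_notMem_tsupport (f := x) fun hx => hp ⟨hb, hx⟩, mul_zero]
  · rw [image_eq_zero_of_notMem_tsupport (f := b) hb, zero_mul]

/-- The map `b ⊗ x ↦ ((w, e) ↦ b w * x e)`. -/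
noncomputable def mulMap : C_c(O.Y, ℂ) ⊗[ℂ] C_c(G.E, ℂ) →ₗ[ℂ] C_c(O.EdgeSpace, ℂ) :=
  TensorProduct.lift (LinearMap.mk₂ ℂ
    (fun b x => ⟨⟨fun p : O.EdgeSpace => b p.1.1 * x p.1.2, by fun_prop⟩,
      O.hasCompactSupport_mul b x⟩)
    (fun _ _ _ => by ext; exact add_mul _ _ _) (fun _ _ _ => by ext; exact mul_assoc _ _ _)
    (fun _ _ _ => by ext; exact mul_add _ _ _) (fun _ _ _ => by ext; exact mul_left_comm _ _ _))

theorem mulMap_tmul_apply (b : C_c(O.Y, ℂ)) (x : C_c(G.E, ℂ)) (p : O.EdgeSpace) :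
    O.mulMap (b ⊗ₜ x) p = b p.1.1 * x p.1.2 := rfl

/-- The edges `(w, e)` with `e` fixed are parametrised by the `w` with `α w = r e`; this is how the
fibre sum defining `Λ` enters the inner product of the out-split graph. -/
theorem bijOn_fst (e : G.E) : Set.BijOn (fun p : O.EdgeSpace => p.1.1)
    ((fun p : O.EdgeSpace => p.1.2) ⁻¹' {e}) (O.α ⁻¹' {G.r e}) := by
  refine ⟨fun p hp => ?_, fun p hp q hq h => ?_, fun u hu => ⟨⟨(u, e), hu⟩, rfl, rfl⟩⟩
  · rw [Set.mem_preimage, Set.mem_singleton_iff] at hp ⊢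
    rw [p.2, hp]
  · exact Subtype.ext (Prod.ext h (Eq.trans hp (Eq.symm hq)))

theorem finite_fibre_snd (e : G.E) : ((fun p : O.EdgeSpace => p.1.2) ⁻¹' {e}).Finite :=
  (O.bijOn_fst e).finite_iff_finite.2 (O.finite_fibre_α (G.r e))

/-- Where `α` is injective, `w` is determined by `e` through `α w = r e`. So `g` is in essence a
function of `e` alone, recovered by summing over the fibres of the second projection, and one
elementary tensor is enough. -/
theorem exists_mulMap_eq_of_injOn (g : C_c(O.EdgeSpace, ℂ)) {U K : Set O.Y} (hU : IsOpen U)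
    (hUα : Set.InjOn O.α U) (hK : IsCompact K) (hKU : K ⊆ U)
    (hg : ∀ p : O.EdgeSpace, p.1.1 ∉ K → g p = 0) : g ∈ LinearMap.range O.mulMap := by
  obtain ⟨f, hf1, hf0, hfc, -⟩ := exists_continuous_one_zero_of_isCompact hK hU.isClosed_compl
    (Set.disjoint_compl_right_iff_subset.2 hKU)
  let b : C_c(O.Y, ℂ) := ⟨⟨fun u => (f u : ℂ), by fun_prop⟩,
    hfc.comp_left (g := fun t : ℝ => (t : ℂ)) Complex.ofReal_zero⟩
  have hb1 : ∀ u ∈ K, b u = 1 := fun u hu => by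
    change ((f u : ℝ) : ℂ) = 1
    rw [hf1 hu]; simp
  have hb0 : ∀ u, u ∉ U → b u = 0 := fun u hu => by
    change ((f u : ℝ) : ℂ) = 0
    rw [hf0 hu]; simp
  refine ⟨b ⊗ₜ fibreSum (fun p : O.EdgeSpace => p.1.2) O.isLocalHomeomorph_snd g, ?_⟩
  ext p
  rw [mulMap_tmul_apply]
  by_cases hpU : p.1.1 ∈ U
  -- Another point `q` of the fibre with `g q ≠ 0` would lie over `K ⊆ U` and have the same image
  -- under `α`, hence equal `p`.
  · have hsum : fibreSum (fun p : O.EdgeSpace => p.1.2) O.isLocalHomeomorph_snd g p.1.2 = g p := by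
      rw [fibreSum_apply, finsum_mem_def, finsum_eq_single _ p fun q hq => ?_]
      · rw [Set.indicator_of_mem]
        exact Set.mem_singleton p.1.2
      · refine Set.indicator_apply_eq_zero.2 fun hqp => hg q fun hqK => hq ?_
        have hqp : q.1.2 = p.1.2 := hqp
        refine Subtype.ext (Prod.ext (hUα (hKU hqK) hpU ?_) hqp)
        rw [q.2, p.2, hqp]
    rw [hsum]
    by_cases hpK : p.1.1 ∈ K
    · rw [hb1 _ hpK, one_mul]
    · rw [hg p hpK, mul_zero]
  -- Off `U` the fibre sum may be nonzero, owing to another point of the fibre that lies over `K`;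
  -- the vanishing of `b` removes it.
  · rw [hb0 _ hpU, zero_mul, hg p fun h => hpU (hKU h)]

/-- A partition of unity on `Y`, subordinate to charts of `α`, cuts `f` into finitely many pieces to
which `exists_mulMap_eq_of_injOn` applies. -/
theorem mulMap_surjective : Function.Surjective O.mulMap := by
  intro f
  have hfst : Continuous fun p : O.EdgeSpace => p.1.1 := by fun_prop
  have hK : IsCompact ((fun p : O.EdgeSpace => p.1.1) '' tsupport f) :=
    f.hasCompactSupport.isCompact.image hfst
  choose c hc hαc using O.isLocalHomeomorph_α
  obtain ⟨t, -, ht⟩ := hK.elim_nhds_subcover (fun x => (c x).source)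
    fun x _ => (c x).open_source.mem_nhds (hc x)
  obtain ⟨ρ, hρs, hρ1, -, hρc⟩ := exists_continuous_sum_one_of_isOpen_isCompact
    (n := t.card) (s := fun i => (c (t.equivFin.symm i)).source)
    (fun i => (c _).open_source) hK (by
      intro x hx
      obtain ⟨z, hz, hxz⟩ := Set.mem_iUnion₂.1 (ht hx)
      exact Set.mem_iUnion.2 ⟨t.equivFin ⟨z, hz⟩, by simpa using hxz⟩)
  let g : Fin t.card → C_c(O.EdgeSpace, ℂ) := fun i =>
    (⟨fun p : O.EdgeSpace => (ρ i p.1.1 : ℂ), by fun_prop⟩ : C(O.EdgeSpace, ℂ)) • f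
  have hgf : ∑ i, g i = f := by
    ext p
    rw [CompactlySupportedContinuousMap.sum_apply]
    change ∑ i, (ρ i p.1.1 : ℂ) * f p = f p
    rw [← Finset.sum_mul, ← Complex.ofReal_sum]
    -- The partition sums to one only over the projection of the support of `f`; elsewhere `f`
    -- vanishes.
    by_cases hp : p ∈ tsupport f
    · have h1 : ∑ i, ρ i p.1.1 = 1 := by simpa using hρ1 ⟨p, hp, rfl⟩
      rw [h1, Complex.ofReal_one, one_mul]
    · rw [image_eq_zero_of_notMem_tsupport hp, mul_zero]
  rw [← hgf]
  refine LinearMap.mem_range.1 (Submodule.sum_mem _ fun i _ => ?_)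
  refine O.exists_mulMap_eq_of_injOn (g i) (c (t.equivFin.symm i)).open_source ?_ (hρc i) (hρs i)
    fun p hp => ?_
  · have := (c (t.equivFin.symm i)).injOn
    rwa [← hαc (t.equivFin.symm i)] at this
  · change (ρ i p.1.1 : ℂ) * f p = 0
    rw [image_eq_zero_of_notMem_tsupport hp, Complex.ofReal_zero, zero_mul]

/-- The pre-correspondence of the out-split graph. -/
noncomputable def graphPre : PreCorrespondence O.Y O.Y C_c(O.EdgeSpace, ℂ) :=
  fibrePreCorrespondence (fun p : O.EdgeSpace => p.1.1) (by fun_prop)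
    (fun p : O.EdgeSpace => O.ψ p.1.2) (O.isLocalHomeomorph_ψ.comp O.isLocalHomeomorph_snd)

/-- By sesquilinearity only elementary tensors matter. For these the left side is a sum over `ψ e =
u` with inner sum over `α w = r e`, and the right side is the same sum over pairs `(w, e)`. -/
theorem tensorPre_ip_tensorMap (ξ η : C_c(O.Y, ℂ) ⊗[ℂ] C_c(G.E, ℂ)) :
    O.tensorPre.ip (O.tensorMap ξ) (O.tensorMap η)
      = O.graphPre.ip (O.mulMap ξ) (O.mulMap η) := by
  induction ξ with
  | zero => simp only [map_zero, LinearMap.zero_apply]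
  | add ξ ξ' h h' => simp only [map_add, LinearMap.add_apply, h, h']
  | tmul b x =>
    induction η with
    | zero => simp only [map_zero]
    | add η η' h h' => simp only [map_add, h, h']
    | tmul b' x' =>
      change O.splitPre.ip (G.ι x) (G.correspondence.left
        (O.expectationPre.completion.ip (O.expectationPre.ι b) (O.expectationPre.ι b')) (G.ι x')) = _
      rw [PreCorrespondence.completion_ip_ι, O.left_ι, splitPre_ip_ι]
      ext u
      change ∑ᶠ e ∈ O.ψ ⁻¹' {u}, conj (x e)
          * ((∑ᶠ w ∈ O.α ⁻¹' {G.r e}, conj (b w) * b' w) * x' e)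
        = ∑ᶠ p ∈ (O.ψ ∘ fun p : O.EdgeSpace => p.1.2) ⁻¹' {u},
          conj (b p.1.1 * x p.1.2) * (b' p.1.1 * x' p.1.2)
      rw [← finsum_mem_fibre_comp (O.finite_fibre_ψ u) O.finite_fibre_snd]
      refine finsum_mem_congr rfl fun e _ => ?_
      rw [mul_comm _ (x' e), ← mul_assoc, mul_finsum_mem]
      refine (finsum_mem_eq_of_bijOn _ (O.bijOn_fst e) fun p hp => ?_).symm
      have hp : p.1.2 = e := hp
      rw [hp, map_mul]
      ring

theorem tensorPre_left_tensorMap (b : C₀(O.Y, ℂ)) (ξ : C_c(O.Y, ℂ) ⊗[ℂ] C_c(G.E, ℂ)) :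
    O.tensorPre.left b (O.tensorMap ξ) = O.tensorMap ((O.expectationPre.left b).rTensor _ ξ) := by
  refine LinearMap.congr_fun (f := O.tensorPre.left b ∘ₗ O.tensorMap)
    (g := O.tensorMap ∘ₗ (O.expectationPre.left b).rTensor _) (TensorProduct.ext' fun c x => ?_) ξ
  exact congrArg (fun z => z ⊗ₜ[ℂ] G.ι x) (O.expectationPre.completion_left_ι b c)

theorem tensorPre_right_tensorMap (b : C₀(O.Y, ℂ)) (ξ : C_c(O.Y, ℂ) ⊗[ℂ] C_c(G.E, ℂ)) :
    O.tensorPre.right b (O.tensorMap ξ) = O.tensorMap ((O.psiPre.right b).lTensor _ ξ) := by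
  refine LinearMap.congr_fun (f := O.tensorPre.right b ∘ₗ O.tensorMap)
    (g := O.tensorMap ∘ₗ (O.psiPre.right b).lTensor _) (TensorProduct.ext' fun c x => ?_) ξ
  exact congrArg (fun z => O.expectationPre.ι c ⊗ₜ[ℂ] z) (O.rightAct_ι b x)

theorem graphPre_left_mulMap (b : C₀(O.Y, ℂ)) (ξ : C_c(O.Y, ℂ) ⊗[ℂ] C_c(G.E, ℂ)) :
    O.graphPre.left b (O.mulMap ξ)
      = O.mulMap ((O.expectationPre.left b).rTensor _ ξ) := by
  refine LinearMap.congr_fun (f := O.graphPre.left b ∘ₗ O.mulMap)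
    (g := O.mulMap ∘ₗ (O.expectationPre.left b).rTensor _)
    (TensorProduct.ext' fun c x => CompactlySupportedContinuousMap.ext fun p => ?_) ξ
  change b p.1.1 * (c p.1.1 * x p.1.2) = b p.1.1 * c p.1.1 * x p.1.2
  ring

theorem graphPre_right_mulMap (b : C₀(O.Y, ℂ)) (ξ : C_c(O.Y, ℂ) ⊗[ℂ] C_c(G.E, ℂ)) :
    O.graphPre.right b (O.mulMap ξ)
      = O.mulMap ((O.psiPre.right b).lTensor _ ξ) := by
  refine LinearMap.congr_fun (f := O.graphPre.right b ∘ₗ O.mulMap)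
    (g := O.mulMap ∘ₗ (O.psiPre.right b).lTensor _)
    (TensorProduct.ext' fun c x => CompactlySupportedContinuousMap.ext fun p => ?_) ξ
  change b (O.ψ p.1.2) * (c p.1.1 * x p.1.2) = c p.1.1 * (b (O.ψ p.1.2) * x p.1.2)
  ring

theorem denseRange_mulMap : DenseRange (O.graphPre.ι ∘ₗ O.mulMap) := by
  have h : Set.range (O.graphPre.ι ∘ O.mulMap) = Set.range O.graphPre.ι :=
    O.mulMap_surjective.range_comp _
  change Dense (Set.range (O.graphPre.ι ∘ O.mulMap))
  rw [h]
  exact O.graphPre.denseRange_ι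

theorem tensorPre_completion_isIsomorphic :
    O.tensorPre.completion.IsIsomorphic O.graphPre.completion := by
  refine PreCorrespondence.completion_isIsomorphic_of_denseRange O.tensorPre O.graphPre
    O.tensorMap O.mulMap ?_ ?_ ?_ (fun b => (O.expectationPre.left b).rTensor _)
    (fun b => (O.psiPre.right b).lTensor _) ?_ ?_ ?_ ?_
  · exact O.denseRange_tensorMap
  · exact O.denseRange_mulMap
  · exact O.tensorPre_ip_tensorMap
  · exact O.tensorPre_left_tensorMap
  · exact O.graphPre_left_mulMap
  · exact O.tensorPre_right_tensorMap
  · exact O.graphPre_right_mulMap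

theorem tensor_isIsomorphic :
    (O.expectationModule.tensor O.splitPre).IsIsomorphic O.graph.correspondence :=
  -- Both correspondences unfold by definition to the completions of `tensorPre` and `graphPre`.
  O.tensorPre_completion_isIsomorphic

end OutSplit

/-! ### Density of `C_c(Y)` in `C₀(Y)`. -/

section Density

variable (Y : Type*) [TopologicalSpace Y]

/-- The inclusion of `C_c(Y)` into `C₀(Y)`. -/
noncomputable def compactlySupportedInclusion : C_c(Y, ℂ) →ₗ[ℂ] C₀(Y, ℂ) where
  toFun b := b
  map_add' _ _ := rfl
  map_smul' _ _ := rfl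

theorem denseRange_compactlySupportedInclusion [T2Space Y] [LocallyCompactSpace Y] :
    DenseRange (compactlySupportedInclusion Y) := by
  refine Metric.denseRange_iff.2 fun b ε hε => ?_
  have hev : ∀ᶠ u in Filter.cocompact Y, ‖b u‖ < ε / 2 := by
    have h : Filter.Tendsto (fun u => ‖b u‖) (Filter.cocompact Y) (nhds 0) := by
      simpa using b.zero_at_infty'.norm
    exact h.eventually (gt_mem_nhds (by positivity))
  obtain ⟨K, hK, hKb⟩ := Filter.mem_cocompact.1 hev
  -- The approximant is `f * b`, with `f` a cut-off equal to `1` on a compact set off which `‖b‖ < ε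
  -- / 2`. The error there is `(1 - f) * b` with `0 ≤ 1 - f ≤ 1`.
  obtain ⟨f, hf1, -, hfc, hf01⟩ := exists_continuous_one_zero_of_isCompact hK isClosed_empty
    (Set.disjoint_empty K)
  refine ⟨⟨⟨fun u => (f u : ℂ) * b u, by fun_prop⟩,
    (hfc.comp_left (g := fun t : ℝ => (t : ℂ)) Complex.ofReal_zero).mul_right⟩, ?_⟩
  rw [dist_eq_norm]
  refine (PreCorrespondence.norm_le_of_forall _ (half_pos hε).le fun u => ?_).trans_lt
    (half_lt_self hε)
  change ‖b u - (f u : ℂ) * b u‖ ≤ ε / 2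
  by_cases hu : u ∈ K
  · have h1 : f u = 1 := hf1 hu
    rw [h1, Complex.ofReal_one, one_mul, sub_self, norm_zero]
    positivity
  · have h2 : ‖b u‖ < ε / 2 := hKb hu
    have h3 : b u - (f u : ℂ) * b u = ((1 - f u : ℝ) : ℂ) * b u := by push_cast; ring
    rw [h3, norm_mul, Complex.norm_real, Real.norm_of_nonneg (sub_nonneg.2 (hf01 u).2)]
    have h4 : 1 - f u ≤ 1 := sub_le_self _ (hf01 u).1
    exact (mul_le_of_le_one_left (norm_nonneg _) h4).trans h2.le

end Density

/-! ### The map `Λ`, and its extension for bounded fibres. -/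

namespace OutSplit

variable {G : TopologicalGraph.{u, v}} (O : OutSplit.{u, v, w} G)

/-- A vanishing finite sum of nonnegative terms has only zero terms. Stated for bare functions, so
that it gives faithfulness on `C_c(Y)` and on `C₀(Y)` alike. -/
theorem eq_zero_of_finsum_conj_mul_eq_zero {F : O.Y → ℂ}
    (h : ∀ v, ∑ᶠ u ∈ O.α ⁻¹' {v}, conj (F u) * F u = 0) (u : O.Y) : F u = 0 := by
  have h1 := le_finsum_mem_of_nonneg (O.finite_fibre_α (O.α u))
    (fun z => star_mul_self_nonneg (F z)) (y := u) rfl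
  have h2 : conj (F u) * F u ≤ 0 := h1.trans_eq (h _)
  exact (CStarRing.star_mul_self_eq_zero_iff (F u)).1 (le_antisymm h2 (star_mul_self_nonneg (F u)))

theorem expectation_apply (b : C_c(O.Y, ℂ)) (v : G.V) :
    O.expectation b v = ∑ᶠ u ∈ O.α ⁻¹' {v}, b u := rfl

theorem expectation_nonneg (b : C_c(O.Y, ℂ)) (hb : ∀ u, 0 ≤ b u) (v : G.V) :
    0 ≤ O.expectation b v :=
  fibreSum_nonneg O.α O.isLocalHomeomorph_α b hb v

theorem expectation_faithful (b : C_c(O.Y, ℂ)) (h : O.expectation (star b * b) = 0) : b = 0 := by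
  ext u
  exact O.eq_zero_of_finsum_conj_mul_eq_zero (F := b) (fun v => DFunLike.congr_fun h v) u

theorem expectation_smul (a₁ a₂ : C₀(G.V, ℂ)) (b : C_c(O.Y, ℂ)) :
    O.expectation (O.pullback a₁ • O.pullback a₂ • b) = a₁ • a₂ • O.expectation b := by
  ext v
  change ∑ᶠ u ∈ O.α ⁻¹' {v}, a₁ (O.α u) * (a₂ (O.α u) * b u)
    = a₁ v * (a₂ v * ∑ᶠ u ∈ O.α ⁻¹' {v}, b u)
  rw [mul_finsum_mem, mul_finsum_mem]
  refine finsum_mem_congr rfl fun u hu => ?_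
  have hu : O.α u = v := hu
  rw [hu]

theorem norm_expectation_le {N : ℕ} (hN : ∀ v, (O.α ⁻¹' {v}).ncard ≤ N) (b : C_c(O.Y, ℂ)) :
    ‖(compactlySupportedInclusion G.V ∘ₗ O.expectation) b‖
      ≤ N * ‖compactlySupportedInclusion O.Y b‖ :=
  PreCorrespondence.norm_le_of_forall _ (by positivity) fun v =>
    norm_finsum_mem_le (O.finite_fibre_α v) (hN v)
      (fun u => PreCorrespondence.norm_apply_le (compactlySupportedInclusion O.Y b) u)
      (norm_nonneg _)

/-- The extension of `Λ` to `C₀(Y)`, for uniformly bounded fibres. -/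
noncomputable def expectationL : C₀(O.Y, ℂ) →L[ℂ] C₀(G.V, ℂ) :=
  (compactlySupportedInclusion G.V ∘ₗ O.expectation).extendOfNorm (compactlySupportedInclusion O.Y)

variable {O}

/-- The bound `N` on the fibres supplies the norm estimate needed for the extension to agree with
`Λ` on `C_c(Y)`. -/
theorem HasBoundedFibres.expectationL_coe (h : O.HasBoundedFibres) (b : C_c(O.Y, ℂ)) :
    O.expectationL (compactlySupportedInclusion O.Y b)
      = compactlySupportedInclusion G.V (O.expectation b) := by
  obtain ⟨N, hN⟩ := h
  exact LinearMap.extendOfNorm_eq (denseRange_compactlySupportedInclusion O.Y)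
    ⟨N, O.norm_expectation_le hN⟩ b

theorem HasBoundedFibres.expectationL_apply (h : O.HasBoundedFibres) (b : C₀(O.Y, ℂ)) (v : G.V) :
    O.expectationL b v = ∑ᶠ u ∈ O.α ⁻¹' {v}, b u := by
  refine (denseRange_compactlySupportedInclusion O.Y).induction_on b (isClosed_eq
    ((PreCorrespondence.continuous_eval v).comp O.expectationL.continuous)
    (continuous_finsum_mem (O.finite_fibre_α v) PreCorrespondence.continuous_eval)) fun b => ?_
  rw [h.expectationL_coe]
  rfl

theorem HasBoundedFibres.expectationL_nonneg (h : O.HasBoundedFibres) (b : C₀(O.Y, ℂ))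
    (hb : ∀ u, 0 ≤ b u) (v : G.V) : 0 ≤ O.expectationL b v := by
  rw [h.expectationL_apply]
  exact finsum_mem_induction (fun z : ℂ => 0 ≤ z) le_rfl (fun _ _ => add_nonneg) fun u _ => hb u

theorem HasBoundedFibres.expectationL_faithful (h : O.HasBoundedFibres) (b : C₀(O.Y, ℂ))
    (hb : O.expectationL (star b * b) = 0) : b = 0 := by
  ext u
  refine O.eq_zero_of_finsum_conj_mul_eq_zero (F := b) (fun v => ?_) u
  have := DFunLike.congr_fun hb v
  rwa [h.expectationL_apply] at this

theorem HasBoundedFibres.expectationL_mul (h : O.HasBoundedFibres) (a₁ a₂ : C₀(G.V, ℂ))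
    (b : C₀(O.Y, ℂ)) :
    O.expectationL (O.pullback a₁ * b * O.pullback a₂) = a₁ * O.expectationL b * a₂ := by
  ext v
  rw [h.expectationL_apply]
  change _ = a₁ v * O.expectationL b v * a₂ v
  rw [h.expectationL_apply, mul_finsum_mem, finsum_mem_mul]
  refine finsum_mem_congr rfl fun u hu => ?_
  have hu : O.α u = v := hu
  change a₁ (O.α u) * b u * a₂ (O.α u) = _
  rw [hu]

theorem HasBoundedFibres.expectationL_splitPre_ip (h : O.HasBoundedFibres) (x y : G.GraphModule) :
    O.expectationL (O.splitPre.ip x y) = G.correspondence.ip x y := by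
  ext v
  rw [h.expectationL_apply, finsum_splitPre_ip]

/-- The `B`-norm is equivalent to the norm of `X(E)`, which is complete. -/
theorem HasBoundedFibres.completeSpace_carrier (h : O.HasBoundedFibres) :
    CompleteSpace O.splitPre.Carrier := by
  obtain ⟨N, hN⟩ := h
  have hc : ∀ x : G.GraphModule, ‖O.splitPre.toCarrier x‖ = ‖O.toPsi x‖ := fun x => by
    rw [PreCorrespondence.norm_toCarrier, norm_splitPre_ip_self, Real.sqrt_sq (norm_nonneg _)]
  have h1 : ∀ x : G.GraphModule, ‖O.splitPre.toCarrier x‖ ≤ 1 * ‖x‖ := fun x => by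
    rw [hc, one_mul]
    exact O.norm_toPsi_le x
  -- Each value of `(x ∣ x)_A` is a sum of at most `N` values of `(x ∣ x)_B`; the square root comes
  -- from passing to norms.
  have h2 : ∀ x : G.GraphModule, ‖x‖ ≤ √N * ‖O.splitPre.toCarrier x‖ := fun x => by
    refine le_of_sq_le_sq ?_ (by positivity)
    rw [mul_pow, Real.sq_sqrt (Nat.cast_nonneg N), PreCorrespondence.norm_sq_toCarrier,
      G.correspondence.norm_sq]
    refine PreCorrespondence.norm_le_of_forall _ (by positivity) fun v => ?_
    rw [← O.finsum_splitPre_ip]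
    exact norm_finsum_mem_le (O.finite_fibre_α v) (hN v)
      (fun u => PreCorrespondence.norm_apply_le _ u) (norm_nonneg _)
  let e := O.splitPre.toCarrier.toContinuousLinearEquivOfBounds 1 √N h1 fun x => by
    obtain ⟨x, rfl⟩ := O.splitPre.toCarrier.surjective x
    rw [LinearEquiv.symm_apply_apply]
    exact h2 x
  exact (completeSpace_congr (e := e.toEquiv) e.isUniformEmbedding).1 inferInstance

/-- The square of the left side is `‖Λ (star b * b)‖`, at most `N ‖b‖ ^ 2`. -/
theorem norm_expectationPre_ι_le {N : ℕ} (hN : ∀ v, (O.α ⁻¹' {v}).ncard ≤ N) (b : C_c(O.Y, ℂ)) :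
    ‖O.expectationPre.ι b‖ ≤ √N * ‖compactlySupportedInclusion O.Y b‖ := by
  refine le_of_sq_le_sq ?_ (by positivity)
  rw [mul_pow, Real.sq_sqrt (Nat.cast_nonneg N), PreCorrespondence.norm_sq_ι, sq]
  refine (O.norm_expectation_le hN (star b * b)).trans ?_
  gcongr
  refine (norm_mul_le (star (compactlySupportedInclusion O.Y b))
    (compactlySupportedInclusion O.Y b)).trans_eq ?_
  have hs : ‖star (compactlySupportedInclusion O.Y b)‖ = ‖compactlySupportedInclusion O.Y b‖ :=
    norm_star (compactlySupportedInclusion O.Y b)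
  rw [hs]

variable (O)

/-- The extension to `C₀(Y)` of the inclusion `C_c(Y) → B^Λ`, for uniformly bounded fibres. -/
noncomputable def expectationQuot : C₀(O.Y, ℂ) →L[ℂ] Completion O.expectationPre.Carrier :=
  O.expectationPre.ι.extendOfNorm (compactlySupportedInclusion O.Y)

variable {O}

theorem HasBoundedFibres.expectationQuot_coe (h : O.HasBoundedFibres) (b : C_c(O.Y, ℂ)) :
    O.expectationQuot (compactlySupportedInclusion O.Y b) = O.expectationPre.ι b := by
  obtain ⟨N, hN⟩ := h
  exact LinearMap.extendOfNorm_eq (denseRange_compactlySupportedInclusion O.Y)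
    ⟨√N, norm_expectationPre_ι_le hN⟩ b

theorem HasBoundedFibres.denseRange_expectationQuot (h : O.HasBoundedFibres) :
    DenseRange O.expectationQuot := by
  refine O.expectationPre.denseRange_ι.mono ?_
  rintro _ ⟨b, rfl⟩
  exact ⟨compactlySupportedInclusion O.Y b, h.expectationQuot_coe b⟩

/-- Both sides are continuous on `C₀(Y)` and coincide on `C_c(Y)`, where the inner product of `B^Λ`
is defined through `Λ`. The two action formulae below hold by the same density argument. -/
theorem HasBoundedFibres.expectationModule_ip (h : O.HasBoundedFibres) (b c : C₀(O.Y, ℂ)) :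
    O.expectationModule.ip (O.expectationQuot b) (O.expectationQuot c)
      = O.expectationL (star b * c) := by
  refine (denseRange_compactlySupportedInclusion O.Y).induction_on₂
    (p := fun b c => O.expectationPre.ipC (O.expectationQuot b) (O.expectationQuot c)
      = O.expectationL (star b * c)) (isClosed_eq
        (O.expectationPre.continuous_ipC (O.expectationQuot.continuous.comp continuous_fst)
          (O.expectationQuot.continuous.comp continuous_snd))
        (O.expectationL.continuous.comp
          ((continuous_star.comp continuous_fst).mul continuous_snd))) (fun b c => ?_) b c
  rw [h.expectationQuot_coe, h.expectationQuot_coe, PreCorrespondence.ipC_ι]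
  exact (h.expectationL_coe (star b * c)).symm

theorem HasBoundedFibres.expectationModule_left (h : O.HasBoundedFibres) (b c : C₀(O.Y, ℂ)) :
    O.expectationModule.left b (O.expectationQuot c) = O.expectationQuot (b * c) := by
  change O.expectationPre.leftC b (O.expectationQuot c) = _
  refine (denseRange_compactlySupportedInclusion O.Y).induction_on c (isClosed_eq
    ((O.expectationPre.continuous_leftC b).comp O.expectationQuot.continuous)
    (O.expectationQuot.continuous.comp (continuous_const.mul continuous_id))) fun c => ?_
  rw [h.expectationQuot_coe, PreCorrespondence.leftC_ι]
  exact (h.expectationQuot_coe (O.expectationPre.left b c)).symm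

theorem HasBoundedFibres.expectationModule_right (h : O.HasBoundedFibres) (b : C₀(O.Y, ℂ))
    (a : C₀(G.V, ℂ)) :
    O.expectationModule.right a (O.expectationQuot b) = O.expectationQuot (b * O.pullback a) := by
  change O.expectationPre.rightC a (O.expectationQuot b) = _
  refine (denseRange_compactlySupportedInclusion O.Y).induction_on b (isClosed_eq
    ((O.expectationPre.continuous_rightC a).comp O.expectationQuot.continuous)
    (O.expectationQuot.continuous.comp (continuous_id.mul continuous_const))) fun b => ?_
  -- The right action on `C_c(Y)` is implemented with the factor `a ∘ α` on the left.
  rw [h.expectationQuot_coe, PreCorrespondence.rightC_ι, mul_comm]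
  exact (h.expectationQuot_coe (O.expectationPre.right a b)).symm

end OutSplit

/-! ### The theorem. -/

theorem mainTheorem8 (G : TopologicalGraph.{u, v}) (hG : G.IsRegular) (O : OutSplit.{u, v, w} G) :
    ∃ (αs : C₀(G.V, ℂ) →⋆ₙₐ[ℂ] C₀(O.Y, ℂ)) (P : PreCorrespondence G.V O.Y G.GraphModule),
      -- `αs` is the injective `*`-homomorphism `a ↦ a ∘ α`
      (∀ a u, αs a u = a (O.α u)) ∧ Function.Injective αs ∧
      -- the map `Λ` on `C_c(Y)`: formula, positivity, faithfulness, compatibility with `αs`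
      (∀ b v, O.expectation b v = ∑ᶠ u ∈ O.α ⁻¹' {v}, b u) ∧
      (∀ b : C_c(O.Y, ℂ), (∀ u, 0 ≤ b u) → ∀ v, 0 ≤ O.expectation b v) ∧
      (∀ b : C_c(O.Y, ℂ), O.expectation (star b * b) = 0 → b = 0) ∧
      (∀ (a₁ a₂ : C₀(G.V, ℂ)) (b : C_c(O.Y, ℂ)),
        O.expectation (αs a₁ • αs a₂ • b) = a₁ • a₂ • O.expectation b) ∧
      -- the right `C₀(Y)`-module structure `P` on `X(E)`: the formulae on `C_c(E)`
      (∀ (x z : C_c(G.E, ℂ)) (b : C₀(O.Y, ℂ)), (∀ e, z e = x e * b (O.ψ e)) →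
        P.right b (G.ι x) = G.ι z) ∧
      (∀ (x y : C_c(G.E, ℂ)) (u : O.Y),
        P.ip (G.ι x) (G.ι y) u = ∑ᶠ e ∈ O.ψ ⁻¹' {u}, conj (x e) * y e) ∧
      (∀ x, P.ip x x = 0 → x = 0) ∧
      -- the left action on `P` (by adjointable operators) is that of `X(E)`
      P.left = G.correspondence.left ∧
      -- `P` is compatible with `αs` and `Λ`
      (∀ x a, P.right (αs a) x = G.correspondence.right a x) ∧
      (∀ x y v, ∑ᶠ u ∈ O.α ⁻¹' {v}, P.ip x y u = G.correspondence.ip x y v) ∧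
      -- the out-split correspondence is isomorphic to the correspondence of the out-split graph
      (O.expectationModule.tensor P).IsIsomorphic O.graph.correspondence ∧
      -- if the fibres of `α` are uniformly bounded, then `Λ` is defined on `C₀(Y)`, `X(E)` is complete
      -- as a `C₀(Y)`-module, and `B^Λ` is the completion of `C₀(Y)`
      (O.HasBoundedFibres →
        CompleteSpace P.Carrier ∧
        ∃ (Λ : C₀(O.Y, ℂ) →L[ℂ] C₀(G.V, ℂ))
          (q : C₀(O.Y, ℂ) →ₗ[ℂ] Completion O.expectationPre.Carrier),
          (∀ b v, Λ b v = ∑ᶠ u ∈ O.α ⁻¹' {v}, b u) ∧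
          (∀ b : C₀(O.Y, ℂ), (∀ u, 0 ≤ b u) → ∀ v, 0 ≤ Λ b v) ∧
          (∀ b, Λ (star b * b) = 0 → b = 0) ∧
          (∀ a₁ a₂ b, Λ (αs a₁ * b * αs a₂) = a₁ * Λ b * a₂) ∧
          (∀ x y, Λ (P.ip x y) = G.correspondence.ip x y) ∧
          (∀ b : C_c(O.Y, ℂ), q b = O.expectationPre.ι b) ∧ DenseRange q ∧
          (∀ b c, O.expectationModule.ip (q b) (q c) = Λ (star b * c)) ∧
          (∀ b c, O.expectationModule.left b (q c) = q (b * c)) ∧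
          (∀ b a, O.expectationModule.right a (q b) = q (b * αs a))) := by
  refine ⟨O.pullback, O.splitPre, O.pullback_apply, O.pullback_injective, O.expectation_apply,
    O.expectation_nonneg, O.expectation_faithful, O.expectation_smul, fun x z b hz => ?_,
    fun x y u => ?_, O.splitPre_definite, rfl, O.splitPre_right_pullback, O.finsum_splitPre_ip,
    O.tensor_isIsomorphic, fun h => ⟨h.completeSpace_carrier, O.expectationL, O.expectationQuot,
      h.expectationL_apply, h.expectationL_nonneg, h.expectationL_faithful, h.expectationL_mul,
      h.expectationL_splitPre_ip, h.expectationQuot_coe, h.denseRange_expectationQuot,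
      h.expectationModule_ip, h.expectationModule_left, h.expectationModule_right⟩⟩
  · refine (O.rightAct_ι b x).trans (congrArg G.ι ?_)
    ext e
    rw [hz e, mul_comm]
    rfl
  · rw [O.splitPre_ip_ι, O.psiPre_ip_apply]
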